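/- Let $d\ge 0$, $n\ge 1$, $\varepsilon>0$, $\rho\ge 0$, let $\nu=\mathcal N(m,\Sigma)$ be the Gaussian distribution on $\mathbb R^d$ with mean $m$ and positive definite covariance $\Sigma$, let $\hat\xi_1,\dots,\hat\xi_n\in\mathbb R^d$ and $\hat{\mathbb P}_n=\frac1n\sum_{i=1}^n\delta_{\hat\xi_i}$. For a probability measure $\mathbb P$ on $\mathbb R^d$ put $$W^{\varepsilon}(\hat{\mathbb P}_n,\mathbb P)=\inf_{\gamma}\Big\{\mathbb E_{(x,y)\sim\gamma}\big[\|x-y\|^2\big]+\varepsilon\,H\big(\gamma\,|\,\hat{\mathbb P}_n\times\nu\big)\Big\},$$ where $\gamma$ ranges over all couplings of $\hat{\mathbb P}_n$ (first marginal) and $\mathbb P$ (second marginal), $H$ is the Kullback--Leibler divergence ($+\infty$ if $\gamma\not\ll\hat{\mathbb P}_n\times\nu$), and let $\mathbb B_{\rho,\varepsilon}(\hat{\mathbb P}_n)$ be the set of all probability measures $\mathbb P$ with $W^{\varepsilon}(\hat{\mathbb P}_n,\mathbb P)\le\rho$. Let $\ell(z)=z^\top Qz+2q^\top z$ with $Q\in\mathbb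 R^{d\times d}$ symmetric positive semidefinite and $q\in\mathbb R^d$. Write $\|m\|_{\Sigma^{-1}}^2=m^\top\Sigma^{-1}m$ and $|A|=\det A$. Then: 1. The worst-case risk problem $$\sup_{\mathbb P\in\mathbb B_{\rho,\varepsilon}(\hat{\mathbb P}_n)}\mathbb E_{z\sim\mathbb P}[\ell(z)]$$ is feasible, i.e. $\mathbb B_{\rho,\varepsilon}(\hat{\mathbb P}_n)\neq\emptyset$, if and only if $$\rho\ \ge\ \tfrac{\varepsilon}{2}\log\big|\Sigma+\tfrac{\varepsilon}{2}I\big|-\tfrac{\varepsilon d}{2}\log\tfrac{\varepsilon}{2}+\tfrac{\varepsilon}{2}\|m\|^2_{\Sigma^{-1}}+\frac1n\sum_{i=1}^n\Big(\|\hat\xi_i\|^2-\big(\hat\xi_i+\tfrac{\varepsilon}{2}\Sigma^{-1}m\big)^\top\big(I+\tfrac{\varepsilon}{2}\Sigma^{-1}\big)^{-1}\big(\hat\xi_i+\tfrac{\varepsilon}{2}\Sigma^{-1}m\big)\Big).$$ Moreover $\ell$ is integrable with respect to every $\mathbb P\in\mathbb B_{\rho,\varepsilon}(\hat{\mathbb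 P}_n)$. 2. The optimal value of the worst-case risk problem equals, as an extended real number (with $\sup\emptyset=-\infty$), the optimal value of the following optimization problem in $(\lambda,s)\in\mathbb R\times\mathbb R^n$, which is convex (its feasible set and its objective are convex): $$\begin{aligned}\inf\ \ &\lambda\rho+\frac1n\sum_{i=1}^n s_i\\ \text{s.t.}\ \ &\lambda\ge0,\qquad M_\lambda:=\lambda\big(I+\tfrac{\varepsilon}{2}\Sigma^{-1}\big)-Q\succ0,\quad\text{and for all } i\in\{1,\dots,n\}:\\ &\tfrac{\lambda\varepsilon d}{2}\log\tfrac{\lambda\varepsilon}{2}-\tfrac{\lambda\varepsilon}{2}\log|\Sigma|-\tfrac{\lambda\varepsilon}{2}\log|M_\lambda|\\ &\ +\big(q+\lambda(\hat\xi_i+\tfrac{\varepsilon}{2}\Sigma^{-1}m)\big)^\top M_\lambda^{-1}\big(q+\lambda(\hat\xi_i+\tfrac{\varepsilon}{2}\Sigma^{-1}m)\big)-\lambda\|\hat\xi_i\|^2-\tfrac{\lambda\varepsilon}{2}\|m\|^2_{\Sigma^{-1}}\ \le\ s_i\,,\end{aligned}$$ where $0\log 0=0$. -/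

import Mathlib

open MeasureTheory Matrix
open scoped ENNReal NNReal

noncomputable section

/-- `γ` is a coupling of `P` and `Q`: a measure on the product with marginals `P` and `Q`
(it is a probability measure whenever `P` is one). -/
def IsCoupling {Z : Type*} [MeasurableSpace Z] (P Q : Measure Z) (γ : Measure (Z × Z)) : Prop :=
  γ.map Prod.fst = P ∧ γ.map Prod.snd = Q

/-- The Sinkhorn discrepancy between `P` and `Q` for the transport cost `c`, the regularization
parameter `ε` and the reference probability measures `μ`, `ν`: the infimum over all couplings `γ`
of `𝔼_γ[c] + ε H(γ | μ × ν)`. The relative entropy is `∞` when `γ` is not absolutely continuous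
with respect to `μ × ν`. -/
def sinkhornDiscrepancy {Z : Type*} [MeasurableSpace Z] (c : Z → Z → ℝ≥0) (ε : ℝ)
    (μ ν P Q : Measure Z) : ℝ≥0∞ :=
  ⨅ (γ : Measure (Z × Z)) (_ : IsCoupling P Q γ),
    (∫⁻ p, (c p.1 p.2 : ℝ≥0∞) ∂γ)
      + ENNReal.ofReal ε * InformationTheory.klDiv γ (μ.prod ν)

/-- The Sinkhorn ambiguity set of radius `ρ` around the nominal distribution `P`, with reference
measure `ν`. The first reference measure is the nominal distribution `P` itself. -/
def sinkhornBall {Z : Type*} [MeasurableSpace Z] (c : Z → Z → ℝ≥0) (ε ρ : ℝ)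
    (ν P : Measure Z) : Set (Measure Z) :=
  {Q | IsProbabilityMeasure Q ∧ sinkhornDiscrepancy c ε P ν P Q ≤ ENNReal.ofReal ρ}

/-- The worst-case risk of the loss `ℓ` over a set `B` of distributions, as an extended real
(the supremum over the empty set is `-∞`). -/
def worstCaseRisk {Z : Type*} [MeasurableSpace Z] (B : Set (Measure Z)) (ℓ : Z → ℝ) : EReal :=
  ⨆ P ∈ B, ((∫ z, ℓ z ∂P : ℝ) : EReal)

/-- The empirical distribution `(1/n) ∑ᵢ δ_{ξᵢ}`. -/
def empiricalMeasure {Z : Type*} [MeasurableSpace Z] {n : ℕ} (ξ : Fin n → Z) : Measure Z :=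
  (n : ℝ≥0∞)⁻¹ • ∑ i, Measure.dirac (ξ i)

/-- The transportation cost `‖x - y‖²`. -/
def sqDistCost {d : ℕ} (x y : EuclideanSpace ℝ (Fin d)) : ℝ≥0 :=
  ‖x - y‖₊ ^ 2

/-- The quadratic form `xᵀ A x`. -/
def quadForm {d : ℕ} (A : Matrix (Fin d) (Fin d) ℝ) (x : EuclideanSpace ℝ (Fin d)) : ℝ :=
  x.ofLp ⬝ᵥ (A *ᵥ x.ofLp)

/-- The vector `A x`. -/
def matVec {d : ℕ} (A : Matrix (Fin d) (Fin d) ℝ) (x : EuclideanSpace ℝ (Fin d)) :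
    EuclideanSpace ℝ (Fin d) :=
  WithLp.toLp 2 (A *ᵥ x.ofLp)

/-- The Gaussian distribution with mean `m` and (positive definite) covariance matrix `S`, through
its density with respect to the Lebesgue measure. -/
def gaussianDist {d : ℕ} (m : EuclideanSpace ℝ (Fin d)) (S : Matrix (Fin d) (Fin d) ℝ) :
    Measure (EuclideanSpace ℝ (Fin d)) :=
  volume.withDensity fun x => ENNReal.ofReal
    ((Real.sqrt ((2 * Real.pi) ^ d * S.det))⁻¹ * Real.exp (-(1 / 2) * quadForm S⁻¹ (x - m)))

/-- The quadratic loss `zᵀ Q z + 2 qᵀ z`. -/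
def quadLoss {d : ℕ} (Q : Matrix (Fin d) (Fin d) ℝ) (q z : EuclideanSpace ℝ (Fin d)) : ℝ :=
  quadForm Q z + 2 * (q.ofLp ⬝ᵥ z.ofLp)

/-- The right-hand side of the feasibility condition on the radius. -/
def criticalRadius {d n : ℕ} (ε : ℝ) (m : EuclideanSpace ℝ (Fin d))
    (S : Matrix (Fin d) (Fin d) ℝ) (ξ : Fin n → EuclideanSpace ℝ (Fin d)) : ℝ :=
  ε / 2 * Real.log (S + (ε / 2) • (1 : Matrix (Fin d) (Fin d) ℝ)).det
    - ε * d / 2 * Real.log (ε / 2)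
    + ε / 2 * quadForm S⁻¹ m
    + 1 / (n : ℝ) * ∑ i, (‖ξ i‖ ^ 2
        - quadForm (1 + (ε / 2) • S⁻¹)⁻¹ (ξ i + (ε / 2) • matVec S⁻¹ m))

/-- The matrix `λ (I + (ε/2) Σ⁻¹) - Q`. -/
def dualMatrix {d : ℕ} (ε : ℝ) (S Q : Matrix (Fin d) (Fin d) ℝ) (lam : ℝ) :
    Matrix (Fin d) (Fin d) ℝ :=
  lam • (1 + (ε / 2) • S⁻¹) - Q

/-- The left-hand side of the epigraph constraint at the sample `x` and the multiplier `lam`. -/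
def epigraphFun {d : ℕ} (ε : ℝ) (m : EuclideanSpace ℝ (Fin d)) (S Q : Matrix (Fin d) (Fin d) ℝ)
    (q x : EuclideanSpace ℝ (Fin d)) (lam : ℝ) : ℝ :=
  lam * ε * d / 2 * Real.log (lam * ε / 2)
    - lam * ε / 2 * Real.log S.det
    - lam * ε / 2 * Real.log (dualMatrix ε S Q lam).det
    + quadForm (dualMatrix ε S Q lam)⁻¹ (q + lam • (x + (ε / 2) • matVec S⁻¹ m))
    - lam * ‖x‖ ^ 2
    - lam * ε / 2 * quadForm S⁻¹ m

/-- The feasible points `(λ, s)` of the dual program. -/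
def dualFeasible {d n : ℕ} (ε : ℝ) (m : EuclideanSpace ℝ (Fin d))
    (S Q : Matrix (Fin d) (Fin d) ℝ) (q : EuclideanSpace ℝ (Fin d))
    (ξ : Fin n → EuclideanSpace ℝ (Fin d)) : Set (ℝ × (Fin n → ℝ)) :=
  {p | 0 ≤ p.1 ∧ (dualMatrix ε S Q p.1).PosDef ∧ ∀ i, epigraphFun ε m S Q q (ξ i) p.1 ≤ p.2 i}

/-- The objective `λ ρ + (1/n) ∑ᵢ sᵢ` of the dual program. -/
def dualObjective {n : ℕ} (ρ : ℝ) (p : ℝ × (Fin n → ℝ)) : ℝ :=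
  p.1 * ρ + 1 / (n : ℝ) * ∑ i, p.2 i

/-- The optimal value of the dual program, as an extended real. -/
def dualValue {d n : ℕ} (ε ρ : ℝ) (m : EuclideanSpace ℝ (Fin d))
    (S Q : Matrix (Fin d) (Fin d) ℝ) (q : EuclideanSpace ℝ (Fin d))
    (ξ : Fin n → EuclideanSpace ℝ (Fin d)) : EReal :=
  ⨅ p ∈ dualFeasible ε m S Q q ξ, ((dualObjective ρ p : ℝ) : EReal)

end

/-! Put `t = 1/λ` and `A_t = I + (ε/2)Σ⁻¹ - tQ`, so that `M_λ = λ A_t`. When `A_t` is positive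
definite, completing the square shows that `exp((tℓ(y) - ‖x-y‖²)/ε)` times the density of `ν` is a
multiple `exp(Λ_t(x)/ε)` of a Gaussian density with covariance `(ε/2)A_t⁻¹`; `Λ_t` is
`logPartition`. The `i`-th dual constraint reads `λ Λ_{1/λ}(ξ_i) ≤ s_i` (`epigraphFun_eq`).

Weak duality is the Gibbs variational inequality `∫ f dγ ≤ H(γ | P̂×ν)` for `f = (tℓ(y) - ‖x-y‖² -
Λ_t(x))/ε`. The first marginal of `γ` is fixed, so it gives `t E_P[ℓ] ≤ cost(γ) + mean Λ_t`
(`mul_integral_quadLoss_le`). The Gibbs coupling with density `exp f` gives equality; write `R(t)`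
for its risk and `c(t) = t R(t) - mean Λ_t` for its cost (`gibbsCoupling_spec`). At `t = 0` the loss
disappears, and `c(0) = -mean Λ_0` is the least cost of any coupling, hence the critical radius.
Testing one multiplier on the Gibbs coupling of another exhibits the constraint functions as suprema
of affine functions of `λ`, which gives convexity.

For strong duality, the gap between the dual value at `1/t` and `R(t)` is `(ρ - c(t))/t`. If `ρ <
c(0)`, letting `t → 0` drives the dual to `-∞`; if `ρ = c(0)`, the same limit yields `R(0)`. If `ρ >
c(0)` and `c` reaches `ρ`, continuity provides a `t` with `c(t) = ρ`, where the gap vanishes.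
Otherwise `c` stays below `ρ`; since `c(t) ≥ (ε/2) tr A_t⁻¹`, the matrix `A_t` can never degenerate
(`tiltMatrix_posDef_of_gibbsCost_lt`), and the gap, at most `ρ/t`, vanishes as `t → ∞`. -/

/-! ### Densities of Gaussian measures -/

open ProbabilityTheory in
/-- The product of standard Gaussian measures through its density. -/
lemma pi_gaussianReal_eq_withDensity (d : ℕ) :
    Measure.pi (fun _ : Fin d ↦ gaussianReal 0 1) =
      (volume : Measure (Fin d → ℝ)).withDensity
        fun x ↦ ENNReal.ofReal (∏ i, gaussianPDFReal 0 1 (x i)) := by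
  refine Measure.pi_eq fun s hs ↦ ?_
  have hind : ∀ i, Integrable ((s i).indicator (gaussianPDFReal 0 1)) volume := fun i ↦
    (integrable_gaussianPDFReal 0 1).indicator (hs i)
  have hnn : ∀ i y, 0 ≤ (s i).indicator (gaussianPDFReal 0 1) y := fun i y ↦
    Set.indicator_nonneg (fun _ _ ↦ gaussianPDFReal_nonneg _ _ _) y
  have key : (Set.univ.pi s).indicator
      (fun x : Fin d → ℝ ↦ ENNReal.ofReal (∏ i, gaussianPDFReal 0 1 (x i))) =
      fun x ↦ ENNReal.ofReal (∏ i, (s i).indicator (gaussianPDFReal 0 1) (x i)) := by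
    ext x
    by_cases hx : x ∈ Set.univ.pi s
    · rw [Set.indicator_of_mem hx]
      congr 1
      refine Finset.prod_congr rfl fun i _ ↦ ?_
      rw [Set.indicator_of_mem (hx i (Set.mem_univ i))]
    · rw [Set.indicator_of_notMem hx]
      simp only [Set.mem_pi, Set.mem_univ, true_imp_iff, not_forall] at hx
      obtain ⟨i, hi⟩ := hx
      rw [Finset.prod_eq_zero (Finset.mem_univ i) (Set.indicator_of_notMem hi _)]
      simp
  have hint : Integrable (fun x : Fin d → ℝ ↦ ∏ i, (s i).indicator (gaussianPDFReal 0 1) (x i))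
      volume := Integrable.fintype_prod hind
  rw [withDensity_apply _ (MeasurableSet.univ_pi hs), ← lintegral_indicator
    (MeasurableSet.univ_pi hs), key, ← ofReal_integral_eq_lintegral_ofReal
    hint
    (Filter.Eventually.of_forall fun x ↦ Finset.prod_nonneg fun i _ ↦ hnn i _),
    integral_fintype_prod_volume_eq_prod (fun i ↦ (s i).indicator (gaussianPDFReal 0 1)),
    ENNReal.ofReal_prod_of_nonneg fun i _ ↦ integral_nonneg (hnn i)]
  refine Finset.prod_congr rfl fun i _ ↦ ?_
  rw [ofReal_integral_eq_lintegral_ofReal (hind i) (Filter.Eventually.of_forall (hnn i)),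
    gaussianReal_of_var_ne_zero _ one_ne_zero, withDensity_apply _ (hs i),
    ← lintegral_indicator (hs i)]
  refine lintegral_congr fun y ↦ ?_
  by_cases hy : y ∈ s i <;> simp [hy, gaussianPDF]

open ProbabilityTheory in
lemma stdGaussian_eq_withDensity (d : ℕ) :
    stdGaussian (EuclideanSpace ℝ (Fin d)) =
      volume.withDensity fun x ↦ ENNReal.ofReal
        ((Real.sqrt ((2 * Real.pi) ^ d))⁻¹ * Real.exp (-(1 / 2) * (x.ofLp ⬝ᵥ x.ofLp))) := by
  rw [← map_pi_eq_stdGaussian, pi_gaussianReal_eq_withDensity]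
  have hmp := PiLp.volume_preserving_toLp (Fin d)
  ext s hs
  rw [Measure.map_apply (by fun_prop) hs, withDensity_apply _ hs,
    withDensity_apply _ (hmp.measurable hs),
    ← hmp.setLIntegral_comp_preimage_emb (MeasurableEquiv.toLp 2 (Fin d → ℝ)).measurableEmbedding]
  refine lintegral_congr fun x ↦ ?_
  congr 1
  simp only [gaussianPDFReal_def, Finset.prod_mul_distrib, Finset.prod_const, Finset.card_univ,
    Fintype.card_fin, ← Real.exp_sum, NNReal.coe_one, mul_one, sub_zero, inv_pow]
  congr 2
  · rw [Real.sqrt_eq_rpow, Real.sqrt_eq_rpow, ← Real.rpow_natCast, ← Real.rpow_natCast,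
      ← Real.rpow_mul (by positivity), ← Real.rpow_mul (by positivity), mul_comm (1 / 2 : ℝ)]
  · simp only [dotProduct, Finset.mul_sum]
    refine Finset.sum_congr rfl fun i _ ↦ by ring

open ProbabilityTheory MatrixOrder in
/-- For a positive definite covariance matrix, the density defines the Gaussian measure of
Mathlib. -/
lemma gaussianDist_eq_multivariateGaussian {d : ℕ} (m : EuclideanSpace ℝ (Fin d))
    {S : Matrix (Fin d) (Fin d) ℝ} (hS : S.PosDef) :
    gaussianDist m S = multivariateGaussian m S := by
  set B := CFC.sqrt S with hB
  have hBB : B * B = S := CFC.sqrt_mul_sqrt_self _ hS.posSemidef.nonneg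
  have hdet : B.det * B.det = S.det := by rw [← det_mul, hBB]
  have hBpos : 0 < B.det := by
    have h1 := hS.det_pos
    have h2 : 0 ≤ B.det := (CFC.sqrt_nonneg S).posSemidef.det_nonneg
    rcases h2.eq_or_lt with h | h
    · rw [← h] at hdet; simp at hdet; linarith
    · exact h
  have hBt : Bᵀ = B := by
    have := (CFC.sqrt_nonneg S).posSemidef.isHermitian
    simpa [IsHermitian, conjTranspose_eq_transpose_of_trivial] using this
  have hBu : IsUnit B.det := hBpos.ne'.isUnit
  have hinv : S⁻¹ = B⁻¹ * B⁻¹ := by rw [← hBB, Matrix.mul_inv_rev]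
  let φ : EuclideanSpace ℝ (Fin d) → EuclideanSpace ℝ (Fin d) :=
    fun x ↦ m + toEuclideanCLM (𝕜 := ℝ) B x
  have hφ : Measurable φ := by fun_prop
  have hdetL : LinearMap.det (toEuclideanLin B) = B.det := by
    exact (congrArg LinearMap.det (congrFun (congrArg DFunLike.coe (toLpLin_eq_toLin 2 2)) B)).trans
      (LinearMap.det_toLin _ B)
  have hvol : (volume : Measure (EuclideanSpace ℝ (Fin d))).map φ =
      ENNReal.ofReal (B.det)⁻¹ • volume := by
    have h1 : φ = (fun x ↦ m + x) ∘ (toEuclideanLin B) := rfl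
    have hc : Continuous (toEuclideanLin B) := LinearMap.continuous_of_finiteDimensional _
    rw [h1, ← Measure.map_map (by fun_prop) hc.measurable,
      Measure.map_linearMap_addHaar_eq_smul_addHaar _ (by rw [hdetL]; exact hBpos.ne'),
      Measure.map_smul, hdetL, abs_of_pos (inv_pos.2 hBpos), (measurePreserving_add_left volume m).map_eq]
  -- Writing Lebesgue measure as a multiple of its image under `φ` turns both measures of a set into
  -- integrals over its preimage.
  have hvol' : (volume : Measure (EuclideanSpace ℝ (Fin d))) =
      ENNReal.ofReal B.det • (volume : Measure (EuclideanSpace ℝ (Fin d))).map φ := by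
    rw [hvol, smul_smul, ← ENNReal.ofReal_mul hBpos.le, mul_inv_cancel₀ hBpos.ne']
    simp
  have hdens : Measurable fun x : EuclideanSpace ℝ (Fin d) => ENNReal.ofReal
    ((Real.sqrt ((2 * Real.pi) ^ d * S.det))⁻¹ * Real.exp (-(1 / 2) * quadForm S⁻¹ (x - m))) := by
    unfold quadForm
    have : Continuous fun x : EuclideanSpace ℝ (Fin d) =>
       ((Real.sqrt ((2 * Real.pi) ^ d * S.det))⁻¹ * Real.exp (-(1 / 2) *
        ((x - m).ofLp ⬝ᵥ (S⁻¹ *ᵥ (x - m).ofLp)))) := by fun_prop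
    exact this.measurable.ennreal_ofReal
  ext s hs
  rw [multivariateGaussian, Measure.map_apply hφ hs, stdGaussian_eq_withDensity, gaussianDist,
    withDensity_apply _ hs, withDensity_apply _ (hφ hs), hvol', Measure.restrict_smul,
    lintegral_smul_measure, setLIntegral_map hs hdens hφ, ← hvol', smul_eq_mul,
    ← lintegral_const_mul _ (by exact hdens.comp hφ)]
  refine lintegral_congr fun x ↦ ?_
  rw [← ENNReal.ofReal_mul hBpos.le]
  congr 1
  have hq : quadForm S⁻¹ (φ x - m) = x.ofLp ⬝ᵥ x.ofLp := by
    simp only [φ, add_sub_cancel_left, quadForm, ofLp_toEuclideanCLM, hinv, mulVec_mulVec]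
    rw [Matrix.mul_assoc, nonsing_inv_mul _ hBu, Matrix.mul_one, dotProduct_mulVec,
      ← mulVec_transpose, transpose_nonsing_inv, hBt, mulVec_mulVec, nonsing_inv_mul _ hBu,
      one_mulVec]
  rw [hq, ← hdet, Real.sqrt_mul (by positivity), Real.sqrt_mul_self hBpos.le]
  field_simp

/-! ### Quadratic forms and trace bounds -/

section QuadForm

variable {d : ℕ}

lemma quadForm_add_matrix (A B : Matrix (Fin d) (Fin d) ℝ) (x : EuclideanSpace ℝ (Fin d)) :
    quadForm (A + B) x = quadForm A x + quadForm B x := by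
  simp [quadForm, add_mulVec]

lemma quadForm_sub_matrix (A B : Matrix (Fin d) (Fin d) ℝ) (x : EuclideanSpace ℝ (Fin d)) :
    quadForm (A - B) x = quadForm A x - quadForm B x := by
  simp [quadForm, sub_mulVec]

lemma quadForm_smul_matrix (c : ℝ) (A : Matrix (Fin d) (Fin d) ℝ) (x : EuclideanSpace ℝ (Fin d)) :
    quadForm (c • A) x = c * quadForm A x := by
  simp [quadForm, smul_mulVec]

lemma quadForm_smul (c : ℝ) (A : Matrix (Fin d) (Fin d) ℝ) (x : EuclideanSpace ℝ (Fin d)) :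
    quadForm A (c • x) = c ^ 2 * quadForm A x := by
  simp [quadForm, mulVec_smul]
  ring

lemma dotProduct_self_eq_norm_sq (x : EuclideanSpace ℝ (Fin d)) :
    x.ofLp ⬝ᵥ x.ofLp = ‖x‖ ^ 2 := by
  rw [EuclideanSpace.real_norm_sq_eq]
  simp [dotProduct, sq]

lemma quadForm_one (x : EuclideanSpace ℝ (Fin d)) :
    quadForm (1 : Matrix (Fin d) (Fin d) ℝ) x = ‖x‖ ^ 2 := by
  rw [quadForm, one_mulVec, dotProduct_self_eq_norm_sq]

lemma dotProduct_mulVec_comm_of_isHermitian {A : Matrix (Fin d) (Fin d) ℝ} (hA : A.IsHermitian)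
    (u v : Fin d → ℝ) : u ⬝ᵥ (A *ᵥ v) = v ⬝ᵥ (A *ᵥ u) := by
  have hAt : Aᵀ = A := by
    simpa [IsHermitian, conjTranspose_eq_transpose_of_trivial] using hA
  rw [dotProduct_mulVec, ← mulVec_transpose, hAt, dotProduct_comm]

lemma quadForm_sub {A : Matrix (Fin d) (Fin d) ℝ} (hA : A.IsHermitian)
    (x y : EuclideanSpace ℝ (Fin d)) :
    quadForm A (x - y) = quadForm A x - 2 * (x.ofLp ⬝ᵥ (A *ᵥ y.ofLp)) + quadForm A y := by
  simp only [quadForm, WithLp.ofLp_sub, mulVec_sub, sub_dotProduct, dotProduct_sub]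
  rw [dotProduct_mulVec_comm_of_isHermitian hA y.ofLp x.ofLp]
  ring

lemma norm_sub_sq_eq_quadLoss (x y : EuclideanSpace ℝ (Fin d)) :
    ‖x - y‖ ^ 2 = quadLoss 1 (-x) y + ‖x‖ ^ 2 := by
  rw [← quadForm_one, quadForm_sub (by simp), quadLoss, one_mulVec, quadForm_one x]
  simp
  ring

lemma matPosDef_iff {A : Matrix (Fin d) (Fin d) ℝ} :
    A.PosDef ↔ A.IsHermitian ∧ ∀ x : EuclideanSpace ℝ (Fin d), x ≠ 0 → 0 < quadForm A x := by
  rw [posDef_iff_dotProduct_mulVec]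
  refine and_congr_right fun _ ↦ ⟨fun h x hx ↦ ?_, fun h x hx ↦ ?_⟩
  · have := h (x := x.ofLp) (by simpa using hx)
    simpa [quadForm] using this
  · have := h (WithLp.toLp 2 x) (by simpa using hx)
    simpa [quadForm] using this

/-- The Frobenius norm bounds the operator norm. -/
lemma dotProduct_mulVec_self_le (C : Matrix (Fin d) (Fin d) ℝ) (u : Fin d → ℝ) :
    (C *ᵥ u) ⬝ᵥ (C *ᵥ u) ≤ (C * Cᵀ).trace * (u ⬝ᵥ u) := by
  simp only [trace, diag_apply, mul_apply, transpose_apply, dotProduct, mulVec, Finset.sum_mul]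
  refine Finset.sum_le_sum fun i _ ↦ ?_
  have := Finset.sum_mul_sq_le_sq_mul_sq Finset.univ (C i) u
  simpa only [← Finset.sum_mul, ← sq] using this

open MatrixOrder in
lemma Matrix.PosSemidef.exists_eq_transpose_mul_self {A : Matrix (Fin d) (Fin d) ℝ}
    (hA : A.PosSemidef) : ∃ C : Matrix (Fin d) (Fin d) ℝ, A = Cᵀ * C := by
  refine ⟨CFC.sqrt A, ?_⟩
  have h : (CFC.sqrt A)ᵀ = CFC.sqrt A := by
    simpa [IsHermitian, conjTranspose_eq_transpose_of_trivial] using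
      (CFC.sqrt_nonneg A).posSemidef.isHermitian
  rw [h, CFC.sqrt_mul_sqrt_self _ hA.nonneg]

lemma quadForm_le_trace_mul {A : Matrix (Fin d) (Fin d) ℝ} (hA : A.PosSemidef)
    (x : EuclideanSpace ℝ (Fin d)) : quadForm A x ≤ A.trace * ‖x‖ ^ 2 := by
  obtain ⟨C, rfl⟩ := hA.exists_eq_transpose_mul_self
  have := dotProduct_mulVec_self_le C x.ofLp
  rwa [dotProduct_mulVec, ← mulVec_transpose, mulVec_mulVec, dotProduct_comm,
    trace_mul_comm, dotProduct_self_eq_norm_sq] at this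

/-- Factor `A⁻¹ = CᵀC`; then `x = Cᵀ(CAx)` and `|CAx|² = xᵀAx`, so the Frobenius bound for `Cᵀ`
applies. Thus a bound on `tr A⁻¹` keeps `A` quantitatively away from singular matrices. -/
lemma norm_sq_le_trace_inv_mul {A : Matrix (Fin d) (Fin d) ℝ} (hA : A.PosDef)
    (x : EuclideanSpace ℝ (Fin d)) : ‖x‖ ^ 2 ≤ A⁻¹.trace * quadForm A x := by
  obtain ⟨C, hC⟩ := hA.inv.posSemidef.exists_eq_transpose_mul_self
  have hu : IsUnit A.det := hA.det_pos.ne'.isUnit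
  have hx : x.ofLp = Cᵀ *ᵥ (C *ᵥ (A *ᵥ x.ofLp)) := by
    rw [mulVec_mulVec, mulVec_mulVec, ← hC, nonsing_inv_mul _ hu, one_mulVec]
  have := dotProduct_mulVec_self_le Cᵀ (C *ᵥ (A *ᵥ x.ofLp))
  rw [← hx, transpose_transpose, ← hC, dotProduct_self_eq_norm_sq] at this
  refine this.trans_eq ?_
  congr 1
  rw [dotProduct_mulVec, ← mulVec_transpose, ← hx, quadForm]

end QuadForm

/-! ### Second moments and expected quadratic losses -/

section Moments

variable {d : ℕ}

lemma integrable_coord_mul {P : Measure (EuclideanSpace ℝ (Fin d))} (hP : MemLp id 2 P)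
    (i j : Fin d) : Integrable (fun y : EuclideanSpace ℝ (Fin d) ↦ y i * y j) P := by
  have h : ∀ i : Fin d, MemLp (fun y : EuclideanSpace ℝ (Fin d) ↦ y i) 2 P := fun i ↦
    (EuclideanSpace.proj (𝕜 := ℝ) i).comp_memLp' hP
  exact (h i).integrable_mul (h j)

lemma integrable_coord {P : Measure (EuclideanSpace ℝ (Fin d))} [IsFiniteMeasure P]
    (hP : MemLp id 2 P) (i : Fin d) :
    Integrable (fun y : EuclideanSpace ℝ (Fin d) ↦ y i) P :=
  ((EuclideanSpace.proj (𝕜 := ℝ) i).comp_memLp' hP).integrable one_le_two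

lemma quadLoss_eq_sum (Q : Matrix (Fin d) (Fin d) ℝ) (q y : EuclideanSpace ℝ (Fin d)) :
    quadLoss Q q y = (∑ i, ∑ j, Q i j * (y i * y j)) + 2 * ∑ i, q i * y i := by
  simp only [quadLoss, quadForm, dotProduct, mulVec, Finset.mul_sum]
  congr 1
  refine Finset.sum_congr rfl fun i _ ↦ Finset.sum_congr rfl fun j _ ↦ by ring

lemma integrable_quadLoss {P : Measure (EuclideanSpace ℝ (Fin d))} [IsFiniteMeasure P]
    (hP : MemLp id 2 P) (Q : Matrix (Fin d) (Fin d) ℝ) (q : EuclideanSpace ℝ (Fin d)) :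
    Integrable (quadLoss Q q) P := by
  rw [show quadLoss Q q = _ from funext (quadLoss_eq_sum Q q)]
  exact (integrable_finsetSum _ fun i _ ↦ integrable_finsetSum _ fun j _ ↦
    (integrable_coord_mul hP i j).const_mul _).add
    ((integrable_finsetSum _ fun i _ ↦ (integrable_coord hP i).const_mul _).const_mul _)

open ProbabilityTheory in
lemma integral_quadLoss_multivariateGaussian {V : Matrix (Fin d) (Fin d) ℝ} (hV : V.PosSemidef)
    (z : EuclideanSpace ℝ (Fin d)) (Q : Matrix (Fin d) (Fin d) ℝ) (q : EuclideanSpace ℝ (Fin d)) :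
    ∫ y, quadLoss Q q y ∂(multivariateGaussian z V) = (Q * V).trace + quadLoss Q q z := by
  set N := multivariateGaussian z V
  have hP : MemLp id 2 N := IsGaussian.memLp_two_id
  have h1 : ∀ i, ∫ y, y i ∂N = z i := fun i ↦ by
    have := (EuclideanSpace.proj (𝕜 := ℝ) i).integral_comp_comm (φ := id) (μ := N)
      (hP.integrable one_le_two)
    simpa [N] using this
  have h2 : ∀ i j, ∫ y, y i * y j ∂N = V i j + z i * z j := fun i j ↦ by
    have hc := covariance_eval_multivariateGaussian (μ := z) hV i j
    have hm : ∀ i : Fin d, MemLp (fun y : EuclideanSpace ℝ (Fin d) ↦ y i) 2 N := fun i ↦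
      (EuclideanSpace.proj (𝕜 := ℝ) i).comp_memLp' hP
    rw [covariance_eq_sub (hm i) (hm j), h1, h1] at hc
    simp only [Pi.mul_apply] at hc
    linarith
  have i1 : ∀ i j, Integrable (fun y : EuclideanSpace ℝ (Fin d) ↦ Q i j * (y i * y j)) N :=
    fun i j ↦ (integrable_coord_mul hP i j).const_mul _
  have i2 : ∀ i, Integrable (fun y : EuclideanSpace ℝ (Fin d) ↦ ∑ j, Q i j * (y i * y j)) N :=
    fun i ↦ integrable_finsetSum _ fun j _ ↦ i1 i j
  have i3 : Integrable (fun y : EuclideanSpace ℝ (Fin d) ↦ ∑ i, ∑ j, Q i j * (y i * y j)) N :=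
    integrable_finsetSum _ fun i _ ↦ i2 i
  have i4 : ∀ i, Integrable (fun y : EuclideanSpace ℝ (Fin d) ↦ q i * y i) N :=
    fun i ↦ (integrable_coord hP i).const_mul _
  have i5 : Integrable (fun y : EuclideanSpace ℝ (Fin d) ↦ 2 * ∑ i, q i * y i) N :=
    (integrable_finsetSum _ fun i _ ↦ i4 i).const_mul _
  have h3 : ∀ i, ∫ y : EuclideanSpace ℝ (Fin d), ∑ j, Q i j * (y i * y j) ∂N =
      ∑ j, Q i j * (V i j + z i * z j) := fun i ↦ by
    rw [integral_finsetSum _ fun j _ ↦ i1 i j]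
    simp only [integral_const_mul, h2]
  have h4 : ∫ y, quadLoss Q q y ∂N = ∑ i, ∑ j, Q i j * (V i j + z i * z j) +
      2 * ∑ i, q i * z i := by
    rw [integral_congr_ae (Filter.Eventually.of_forall (quadLoss_eq_sum Q q)),
      integral_add i3 i5, integral_const_mul, integral_finsetSum _ fun i _ ↦ i2 i,
      integral_finsetSum _ fun i _ ↦ i4 i]
    simp only [h3, integral_const_mul, h1]
  rw [h4, quadLoss_eq_sum]
  have hVs : ∀ i j, V i j = V j i := fun i j ↦ by
    simpa using (hV.isHermitian.apply j i)
  simp only [mul_add, Finset.sum_add_distrib, trace, diag_apply,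
    mul_apply]
  simp only [hVs, add_assoc]

end Moments

/-! ### The tilted Gaussian and its normalizing constant -/

section Tilt

variable {d : ℕ}

/-- The precision matrix, up to the factor `2 / ε`, of the Gaussian tilted by
`(t ℓ(y) - ‖x - y‖²) / ε`. -/
noncomputable def tiltMatrix (ε : ℝ) (S Q : Matrix (Fin d) (Fin d) ℝ) (t : ℝ) :
    Matrix (Fin d) (Fin d) ℝ :=
  1 + (ε / 2) • S⁻¹ - t • Q

/-- The linear part of the exponent of the tilted Gaussian. -/
noncomputable def tiltVec (ε : ℝ) (m : EuclideanSpace ℝ (Fin d)) (S : Matrix (Fin d) (Fin d) ℝ)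
    (q x : EuclideanSpace ℝ (Fin d)) (t : ℝ) : EuclideanSpace ℝ (Fin d) :=
  t • q + (x + (ε / 2) • matVec S⁻¹ m)

/-- The mean of the tilted Gaussian. -/
noncomputable def tiltMean (ε : ℝ) (m : EuclideanSpace ℝ (Fin d)) (S Q : Matrix (Fin d) (Fin d) ℝ)
    (q x : EuclideanSpace ℝ (Fin d)) (t : ℝ) : EuclideanSpace ℝ (Fin d) :=
  matVec (tiltMatrix ε S Q t)⁻¹ (tiltVec ε m S q x t)

/-- `ε` times the logarithm of the normalizing constant of the tilted Gaussian. -/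
noncomputable def logPartition (ε : ℝ) (m : EuclideanSpace ℝ (Fin d))
    (S Q : Matrix (Fin d) (Fin d) ℝ) (q : EuclideanSpace ℝ (Fin d)) (t : ℝ)
    (x : EuclideanSpace ℝ (Fin d)) : ℝ :=
  ε * d / 2 * Real.log (ε / 2) - ε / 2 * Real.log S.det
    - ε / 2 * Real.log (tiltMatrix ε S Q t).det
    + quadForm (tiltMatrix ε S Q t)⁻¹ (tiltVec ε m S q x t)
    - ‖x‖ ^ 2 - ε / 2 * quadForm S⁻¹ m

/-- The expected loss under the tilted Gaussian. -/
noncomputable def tiltRisk (ε : ℝ) (m : EuclideanSpace ℝ (Fin d))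
    (S Q : Matrix (Fin d) (Fin d) ℝ) (q : EuclideanSpace ℝ (Fin d)) (t : ℝ)
    (x : EuclideanSpace ℝ (Fin d)) : ℝ :=
  (Q * ((ε / 2) • (tiltMatrix ε S Q t)⁻¹)).trace + quadLoss Q q (tiltMean ε m S Q q x t)

/-- The log-density of the Gibbs coupling with respect to the product of the reference measures. -/
noncomputable def gibbsExponent (ε : ℝ) (m : EuclideanSpace ℝ (Fin d))
    (S Q : Matrix (Fin d) (Fin d) ℝ) (q : EuclideanSpace ℝ (Fin d)) (t : ℝ)
    (p : EuclideanSpace ℝ (Fin d) × EuclideanSpace ℝ (Fin d)) : ℝ :=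
  (t * quadLoss Q q p.2 - ‖p.1 - p.2‖ ^ 2 - logPartition ε m S Q q t p.1) / ε

variable {ε : ℝ} {m : EuclideanSpace ℝ (Fin d)} {S Q : Matrix (Fin d) (Fin d) ℝ}
  {q : EuclideanSpace ℝ (Fin d)} {t : ℝ}

lemma continuous_logPartition : Continuous (logPartition ε m S Q q t) := by
  unfold logPartition quadForm tiltVec
  fun_prop

lemma continuous_quadLoss : Continuous (quadLoss Q q) := by
  unfold quadLoss quadForm
  fun_prop

lemma continuous_gibbsExponent : Continuous (gibbsExponent ε m S Q q t) := by
  unfold gibbsExponent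
  have h1 := continuous_logPartition (ε := ε) (m := m) (S := S) (Q := Q) (q := q) (t := t)
  have h2 := continuous_quadLoss (Q := Q) (q := q)
  fun_prop

/-- Completing the square in `y`: `tiltMean` is the solution `z` of `A_t z = tiltVec`. -/
lemma tilt_exponent_eq (hS : S.PosDef) (ht : (tiltMatrix ε S Q t).PosDef)
    (x y : EuclideanSpace ℝ (Fin d)) :
    t * quadLoss Q q y - ‖x - y‖ ^ 2 - ε / 2 * quadForm S⁻¹ (y - m) =
      -quadForm (tiltMatrix ε S Q t) (y - tiltMean ε m S Q q x t)
        + quadForm (tiltMatrix ε S Q t)⁻¹ (tiltVec ε m S q x t) - ‖x‖ ^ 2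
        - ε / 2 * quadForm S⁻¹ m := by
  have hu : IsUnit (tiltMatrix ε S Q t).det := ht.det_pos.ne'.isUnit
  have h1 : tiltMatrix ε S Q t *ᵥ (tiltMean ε m S Q q x t).ofLp = (tiltVec ε m S q x t).ofLp := by
    simp only [tiltMean, matVec]
    rw [mulVec_mulVec, mul_nonsing_inv _ hu, one_mulVec]
  have h2 : quadForm (tiltMatrix ε S Q t) (tiltMean ε m S Q q x t) =
      quadForm (tiltMatrix ε S Q t)⁻¹ (tiltVec ε m S q x t) := by
    rw [quadForm, h1, dotProduct_comm, quadForm]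
    rfl
  have h3 : quadForm (tiltMatrix ε S Q t) y = ‖y‖ ^ 2 + ε / 2 * quadForm S⁻¹ y
      - t * quadForm Q y := by
    rw [tiltMatrix, quadForm_sub_matrix, quadForm_add_matrix, quadForm_smul_matrix,
      quadForm_smul_matrix, quadForm_one]
  rw [quadForm_sub ht.isHermitian, h1, h2, h3, quadForm_sub hS.inv.isHermitian,
    norm_sub_sq_eq_quadLoss, quadLoss, quadLoss, quadForm_one]
  simp only [tiltVec, matVec, WithLp.ofLp_add, WithLp.ofLp_smul, dotProduct_add, dotProduct_smul,
    smul_eq_mul, WithLp.ofLp_neg, neg_dotProduct, dotProduct_comm q.ofLp, dotProduct_comm x.ofLp]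
  ring

lemma exp_gibbsExponent_mul_density (hε : 0 < ε) (hS : S.PosDef)
    (ht : (tiltMatrix ε S Q t).PosDef) (x y : EuclideanSpace ℝ (Fin d)) :
    (Real.sqrt ((2 * Real.pi) ^ d * S.det))⁻¹ * Real.exp (-(1 / 2) * quadForm S⁻¹ (y - m)) *
      Real.exp (gibbsExponent ε m S Q q t (x, y)) =
    (Real.sqrt ((2 * Real.pi) ^ d * ((ε / 2) • (tiltMatrix ε S Q t)⁻¹).det))⁻¹ *
      Real.exp (-(1 / 2) * quadForm ((ε / 2) • (tiltMatrix ε S Q t)⁻¹)⁻¹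
        (y - tiltMean ε m S Q q x t)) := by
  have hS0 := hS.det_pos
  have ht0 := ht.det_pos
  have hu : IsUnit (tiltMatrix ε S Q t).det := ht0.ne'.isUnit
  -- Moving the determinants into the exponents leaves the same power of `2π` on both sides, so only
  -- the exponents need comparing.
  have hsqrt : ∀ a : ℝ, 0 < a → (Real.sqrt ((2 * Real.pi) ^ d * a))⁻¹ =
      (Real.sqrt ((2 * Real.pi) ^ d))⁻¹ * Real.exp (-(1 / 2) * Real.log a) := fun a ha ↦ by
    rw [Real.sqrt_mul (by positivity), mul_inv]
    congr 1
    rw [neg_mul, Real.exp_neg, Real.sqrt_eq_rpow, Real.rpow_def_of_pos ha, mul_comm]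
  have hinv : ((ε / 2) • (tiltMatrix ε S Q t)⁻¹)⁻¹ = (2 / ε) • tiltMatrix ε S Q t := by
    refine inv_eq_left_inv ?_
    rw [smul_mul_smul_comm, mul_nonsing_inv _ hu]
    have : 2 / ε * (ε / 2) = 1 := by field_simp
    rw [this, one_smul]
  have hdet : ((ε / 2) • (tiltMatrix ε S Q t)⁻¹).det = (ε / 2) ^ d * (tiltMatrix ε S Q t).det⁻¹ := by
    rw [det_smul, Fintype.card_fin, det_nonsing_inv, Ring.inverse_eq_inv']
  have hlog : Real.log ((ε / 2) • (tiltMatrix ε S Q t)⁻¹).det =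
      d * Real.log (ε / 2) - Real.log (tiltMatrix ε S Q t).det := by
    rw [hdet, Real.log_mul (by positivity) (by positivity), Real.log_pow, Real.log_inv]
    ring
  rw [hsqrt _ hS0, hsqrt _ (by rw [hdet]; positivity), hinv, hlog, quadForm_smul_matrix, mul_assoc,
    mul_assoc, mul_assoc, ← Real.exp_add, ← Real.exp_add, ← Real.exp_add]
  congr 2
  have h := tilt_exponent_eq (q := q) (m := m) hS ht x y
  have h' : t * quadLoss Q q y - ‖x - y‖ ^ 2 = ε / 2 * quadForm S⁻¹ (y - m)
      - quadForm (tiltMatrix ε S Q t) (y - tiltMean ε m S Q q x t)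
        + quadForm (tiltMatrix ε S Q t)⁻¹ (tiltVec ε m S q x t) - ‖x‖ ^ 2
        - ε / 2 * quadForm S⁻¹ m := by linarith
  simp only [gibbsExponent, logPartition]
  rw [h']
  field_simp
  ring

lemma posDef_smul_inv (hε : 0 < ε) {A : Matrix (Fin d) (Fin d) ℝ} (hA : A.PosDef) :
    ((ε / 2) • A⁻¹).PosDef :=
  hA.inv.smul (half_pos hε)

open ProbabilityTheory in
lemma gaussianDist_withDensity_exp_gibbsExponent (hε : 0 < ε) (hS : S.PosDef)
    (ht : (tiltMatrix ε S Q t).PosDef) (x : EuclideanSpace ℝ (Fin d)) :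
    (gaussianDist m S).withDensity
        (fun y ↦ ENNReal.ofReal (Real.exp (gibbsExponent ε m S Q q t (x, y)))) =
      multivariateGaussian (tiltMean ε m S Q q x t) ((ε / 2) • (tiltMatrix ε S Q t)⁻¹) := by
  have hc : Continuous fun y ↦ gibbsExponent ε m S Q q t (x, y) :=
    continuous_gibbsExponent.comp (by fun_prop)
  rw [← gaussianDist_eq_multivariateGaussian _ (posDef_smul_inv hε ht), gaussianDist, gaussianDist,
    ← withDensity_mul]
  · congr 1
    ext y
    rw [Pi.mul_apply, ← ENNReal.ofReal_mul (by positivity), exp_gibbsExponent_mul_density hε hS ht]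
  · unfold quadForm
    have : Continuous fun y : EuclideanSpace ℝ (Fin d) =>
       ((Real.sqrt ((2 * Real.pi) ^ d * S.det))⁻¹ * Real.exp (-(1 / 2) *
        ((y - m).ofLp ⬝ᵥ (S⁻¹ *ᵥ (y - m).ofLp)))) := by fun_prop
    exact this.measurable.ennreal_ofReal
  · exact (Real.continuous_exp.comp hc).measurable.ennreal_ofReal

lemma continuousAt_tiltMatrix_inv (ht : (tiltMatrix ε S Q t).PosDef) :
    ContinuousAt (fun t ↦ (tiltMatrix ε S Q t)⁻¹) t := by
  have h1 : ContinuousAt (fun t ↦ tiltMatrix ε S Q t) t := by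
    unfold tiltMatrix
    fun_prop
  have h2 : ContinuousAt Ring.inverse (tiltMatrix ε S Q t).det := by
    rw [show (Ring.inverse : ℝ → ℝ) = Inv.inv from Ring.inverse_eq_inv']
    exact continuousAt_inv₀ ht.det_pos.ne'
  exact (continuousAt_matrix_inv _ h2).comp h1

lemma continuousAt_logPartition (ht : (tiltMatrix ε S Q t).PosDef)
    (x : EuclideanSpace ℝ (Fin d)) : ContinuousAt (fun t ↦ logPartition ε m S Q q t x) t := by
  have h1 := continuousAt_tiltMatrix_inv ht
  have h2 : ContinuousAt (fun t ↦ Real.log (tiltMatrix ε S Q t).det) t := by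
    refine ContinuousAt.log ?_ ht.det_pos.ne'
    unfold tiltMatrix
    fun_prop
  have h3 : ContinuousAt (fun t ↦ quadForm (tiltMatrix ε S Q t)⁻¹ (tiltVec ε m S q x t)) t := by
    unfold quadForm tiltVec
    fun_prop
  unfold logPartition
  fun_prop

lemma continuousAt_tiltRisk (ht : (tiltMatrix ε S Q t).PosDef)
    (x : EuclideanSpace ℝ (Fin d)) : ContinuousAt (fun t ↦ tiltRisk ε m S Q q t x) t := by
  have h1 := continuousAt_tiltMatrix_inv ht
  have h3 : ContinuousAt (fun t ↦ tiltMean ε m S Q q x t) t := by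
    unfold tiltMean matVec tiltVec
    fun_prop
  have h4 : ContinuousAt (fun t ↦ quadLoss Q q (tiltMean ε m S Q q x t)) t :=
    ContinuousAt.comp (g := quadLoss Q q) continuous_quadLoss.continuousAt h3
  unfold tiltRisk
  fun_prop

lemma tiltMatrix_zero_posDef (hε : 0 < ε) (hS : S.PosDef) : (tiltMatrix ε S Q 0).PosDef := by
  rw [tiltMatrix, zero_smul, sub_zero]
  exact PosDef.one.add (posDef_smul_inv hε hS)

/-- At `t = 0` the loss drops out, so `Q` and `q` are arbitrary; the determinants match through `Σ +
(ε/2)I = Σ A_0`. -/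
lemma criticalRadius_eq {n : ℕ} (hn : 1 ≤ n) (hε : 0 < ε) (hS : S.PosDef)
    (ξ : Fin n → EuclideanSpace ℝ (Fin d)) :
    criticalRadius ε m S ξ = -(1 / (n : ℝ) * ∑ i, logPartition ε m S Q q 0 (ξ i)) := by
  have hn0 : (n : ℝ) ≠ 0 := by positivity
  have ht := tiltMatrix_zero_posDef (Q := Q) hε hS
  have hdet : (S + (ε / 2) • (1 : Matrix (Fin d) (Fin d) ℝ)).det =
      S.det * (tiltMatrix ε S Q 0).det := by
    rw [← det_mul, tiltMatrix, zero_smul, sub_zero, Matrix.mul_add, Matrix.mul_one, mul_smul_comm,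
      mul_nonsing_inv _ hS.det_pos.ne'.isUnit]
  have hA : (1 + (ε / 2) • S⁻¹ : Matrix (Fin d) (Fin d) ℝ) = tiltMatrix ε S Q 0 := by
    rw [tiltMatrix, zero_smul, sub_zero]
  have hv : ∀ x, x + (ε / 2) • matVec S⁻¹ m = tiltVec ε m S q x 0 := fun x ↦ by
    rw [tiltVec, zero_smul, zero_add]
  simp only [criticalRadius, hdet, hA, hv, logPartition]
  rw [Real.log_mul hS.det_pos.ne' ht.det_pos.ne']
  simp only [Finset.sum_sub_distrib, Finset.sum_add_distrib, Finset.sum_const, Finset.card_univ,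
    Fintype.card_fin, nsmul_eq_mul]
  field_simp
  ring

lemma dualMatrix_eq_smul {lam : ℝ} (hl : 0 < lam) :
    dualMatrix ε S Q lam = lam • tiltMatrix ε S Q lam⁻¹ := by
  rw [dualMatrix, tiltMatrix, smul_sub lam, smul_smul, mul_inv_cancel₀ hl.ne', one_smul]

lemma dualMatrix_posDef_iff {lam : ℝ} (hl : 0 < lam) :
    (dualMatrix ε S Q lam).PosDef ↔ (tiltMatrix ε S Q lam⁻¹).PosDef := by
  rw [dualMatrix_eq_smul hl]
  refine ⟨fun h ↦ ?_, fun h ↦ h.smul hl⟩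
  have := h.smul (inv_pos.2 hl)
  rwa [smul_smul, inv_mul_cancel₀ hl.ne', one_smul] at this

/-- Since `|M_λ| = λ^d |A_{1/λ}|`, the resulting `d log λ` cancels the one in `d log(λε/2)`. -/
lemma epigraphFun_eq {lam : ℝ} (hε : 0 < ε) (hl : 0 < lam)
    (ht : (tiltMatrix ε S Q lam⁻¹).PosDef) (x : EuclideanSpace ℝ (Fin d)) :
    epigraphFun ε m S Q q x lam = lam * logPartition ε m S Q q lam⁻¹ x := by
  have hv : q + lam • (x + (ε / 2) • matVec S⁻¹ m) = lam • tiltVec ε m S q x lam⁻¹ := by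
    rw [tiltVec, smul_add lam (lam⁻¹ • q), smul_inv_smul₀ hl.ne']
  have hinv : (lam • tiltMatrix ε S Q lam⁻¹)⁻¹ = lam⁻¹ • (tiltMatrix ε S Q lam⁻¹)⁻¹ := by
    refine inv_eq_left_inv ?_
    rw [smul_mul_smul_comm, nonsing_inv_mul _ ht.det_pos.ne'.isUnit, inv_mul_cancel₀ hl.ne',
      one_smul]
  rw [epigraphFun, logPartition, hv, dualMatrix_eq_smul hl, hinv, quadForm_smul_matrix,
    quadForm_smul, det_smul, Fintype.card_fin, mul_div_assoc lam ε 2,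
    Real.log_mul (by positivity) ht.det_pos.ne', Real.log_pow, Real.log_mul hl.ne' (by positivity)]
  field_simp
  ring

/-- Positive definiteness persists along a step whose size is controlled by the trace of the
inverse. -/
lemma tiltMatrix_posDef_add (hQ : Q.PosSemidef) (ht : (tiltMatrix ε S Q t).PosDef) {C s : ℝ}
    (hC : (tiltMatrix ε S Q t)⁻¹.trace ≤ C) (hs : 0 ≤ s) (hsC : C * (s * Q.trace) < 1) :
    (tiltMatrix ε S Q (t + s)).PosDef := by
  have heq : tiltMatrix ε S Q (t + s) = tiltMatrix ε S Q t - s • Q := by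
    simp only [tiltMatrix, add_smul]
    abel
  rw [matPosDef_iff, heq]
  refine ⟨ht.isHermitian.sub (by simpa using (hQ.smul hs).isHermitian), fun x hx ↦ ?_⟩
  rw [quadForm_sub_matrix, quadForm_smul_matrix]
  have hpos := (matPosDef_iff.1 ht).2 x hx
  have h1 := norm_sq_le_trace_inv_mul ht x
  have h2 := mul_le_mul_of_nonneg_left (quadForm_le_trace_mul hQ x) hs
  have h3 := mul_le_mul_of_nonneg_right hC hpos.le
  have hx2 : 0 < ‖x‖ ^ 2 := by positivity
  have hC0 : 0 ≤ C := ht.inv.posSemidef.trace_nonneg.trans hC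
  -- Otherwise `‖x‖² ≤ C xᵀA_t x ≤ C s tr(Q) ‖x‖² < ‖x‖²`.
  by_contra hcon
  have h4 : C * quadForm (tiltMatrix ε S Q t) x ≤ C * (s * (Q.trace * ‖x‖ ^ 2)) :=
    mul_le_mul_of_nonneg_left (by linarith) hC0
  nlinarith

end Tilt

/-! ### Integration against the empirical measure -/

section Empirical

variable {Z : Type*} [MeasurableSpace Z] {n : ℕ}

lemma isProbabilityMeasure_empiricalMeasure (hn : 1 ≤ n) (ξ : Fin n → Z) :
    IsProbabilityMeasure (empiricalMeasure ξ) := by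
  refine ⟨?_⟩
  have h0 : (n : ℝ≥0∞) ≠ 0 := by exact_mod_cast (by lia : n ≠ 0)
  simp [empiricalMeasure, ENNReal.inv_mul_cancel h0 (ENNReal.natCast_ne_top n)]

lemma lintegral_empiricalMeasure (ξ : Fin n → Z) {g : Z → ℝ≥0∞} (hg : Measurable g) :
    ∫⁻ x, g x ∂(empiricalMeasure ξ) = (n : ℝ≥0∞)⁻¹ * ∑ i, g (ξ i) := by
  rw [empiricalMeasure, lintegral_smul_measure, lintegral_finsetSum_measure, smul_eq_mul]
  simp only [lintegral_dirac' _ hg]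

lemma integral_empiricalMeasure (ξ : Fin n → Z) {g : Z → ℝ} (hg : StronglyMeasurable g) :
    ∫ x, g x ∂(empiricalMeasure ξ) = 1 / (n : ℝ) * ∑ i, g (ξ i) := by
  rw [empiricalMeasure, integral_smul_measure, integral_finsetSum_measure]
  · simp [integral_dirac' _ _ hg]
  · exact fun i _ ↦ integrable_dirac' hg (by simp)

lemma integrable_empiricalMeasure (hn : 1 ≤ n) (ξ : Fin n → Z) {g : Z → ℝ}
    (hg : StronglyMeasurable g) : Integrable g (empiricalMeasure ξ) := by
  have h0 : (n : ℝ≥0∞) ≠ 0 := by exact_mod_cast (by lia : n ≠ 0)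
  exact (integrable_finsetSum_measure.2 fun i _ ↦ integrable_dirac' hg (by simp)).smul_measure
    (ENNReal.inv_ne_top.2 h0)

end Empirical

/-! ### The Gibbs variational principle -/

section Gibbs

variable {α : Type*} [MeasurableSpace α]

lemma integrable_exp_of_lintegral_eq_one {ν : Measure α} {f : α → ℝ} (hf : Measurable f)
    (h1 : ∫⁻ x, ENNReal.ofReal (Real.exp (f x)) ∂ν = 1) :
    Integrable (fun x ↦ Real.exp (f x)) ν :=
  (lintegral_ofReal_ne_top_iff_integrable (Real.measurable_exp.comp hf).aestronglyMeasurable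
    (Filter.Eventually.of_forall fun x ↦ (Real.exp_pos _).le)).1 (by simp [h1])

lemma integral_exp_of_lintegral_eq_one {ν : Measure α} {f : α → ℝ} (hf : Measurable f)
    (h1 : ∫⁻ x, ENNReal.ofReal (Real.exp (f x)) ∂ν = 1) : ∫ x, Real.exp (f x) ∂ν = 1 := by
  rw [integral_eq_lintegral_of_nonneg_ae
    (Filter.Eventually.of_forall fun x ↦ (Real.exp_pos _).le)
    (Real.measurable_exp.comp hf).aestronglyMeasurable, h1]
  simp

/-- The Gibbs variational inequality. -/
lemma integral_le_toReal_klDiv {μ ν : Measure α} [IsProbabilityMeasure μ] [IsProbabilityMeasure ν]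
    {f : α → ℝ} (hf : Measurable f) (h1 : ∫⁻ x, ENNReal.ofReal (Real.exp (f x)) ∂ν = 1)
    (hfμ : Integrable f μ) (hkl : InformationTheory.klDiv μ ν ≠ ∞) :
    ∫ x, f x ∂μ ≤ (InformationTheory.klDiv μ ν).toReal := by
  obtain ⟨hac, hint⟩ := InformationTheory.klDiv_ne_top_iff.1 hkl
  have he := integrable_exp_of_lintegral_eq_one hf h1
  have := isProbabilityMeasure_tilted he
  -- Nonnegativity of the entropy of `μ` relative to `exp(f) ν`; as the normalizing constant is one,
  -- that entropy is `H(μ | ν) - ∫ f dμ`.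
  have h2 := InformationTheory.integral_llr_add_sub_measure_univ_nonneg
    (hac.trans (absolutelyContinuous_tilted he)) (integrable_llr_tilted_right hac hfμ hint he)
  rw [integral_llr_tilted_right hac hfμ he hint, integral_exp_of_lintegral_eq_one hf h1] at h2
  rw [InformationTheory.toReal_klDiv_of_measure_eq hac (by simp)]
  simp at h2
  exact h2

/-- The relative entropy of a measure with log-density `f`. -/
lemma klDiv_withDensity_exp {ν : Measure α} [IsProbabilityMeasure ν] {f : α → ℝ}
    (hf : Measurable f) (h1 : ∫⁻ x, ENNReal.ofReal (Real.exp (f x)) ∂ν = 1)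
    (hfi : Integrable f (ν.withDensity fun x ↦ ENNReal.ofReal (Real.exp (f x)))) :
    0 ≤ ∫ x, f x ∂(ν.withDensity fun x ↦ ENNReal.ofReal (Real.exp (f x))) ∧
    InformationTheory.klDiv (ν.withDensity fun x ↦ ENNReal.ofReal (Real.exp (f x))) ν =
      ENNReal.ofReal (∫ x, f x ∂(ν.withDensity fun x ↦ ENNReal.ofReal (Real.exp (f x)))) := by
  set γ := ν.withDensity fun x ↦ ENNReal.ofReal (Real.exp (f x)) with hγ
  have hm : Measurable fun x ↦ ENNReal.ofReal (Real.exp (f x)) :=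
    (Real.measurable_exp.comp hf).ennreal_ofReal
  have hac : γ ≪ ν := withDensity_absolutelyContinuous _ _
  have : IsProbabilityMeasure γ := ⟨by rw [hγ, withDensity_apply _ .univ, setLIntegral_univ, h1]⟩
  have hllr : llr γ ν =ᵐ[γ] f := by
    filter_upwards [hac.ae_le (Measure.rnDeriv_withDensity ν hm)] with x hx
    rw [llr, hx, ENNReal.toReal_ofReal (Real.exp_pos _).le, Real.log_exp]
  have hint := (integrable_congr hllr).2 hfi
  have h0 := InformationTheory.integral_llr_add_sub_measure_univ_nonneg hac hint
  rw [InformationTheory.klDiv_of_ac_of_integrable hac hint]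
  rw [integral_congr_ae hllr] at h0 ⊢
  simpa using h0

end Gibbs

/-! ### Weak duality for couplings -/

section Weak

variable {d n : ℕ} {ε : ℝ} {m : EuclideanSpace ℝ (Fin d)} {S Q : Matrix (Fin d) (Fin d) ℝ}
  {q : EuclideanSpace ℝ (Fin d)} {t : ℝ} {ξ : Fin n → EuclideanSpace ℝ (Fin d)}
  {P : Measure (EuclideanSpace ℝ (Fin d))}
  {γ : Measure (EuclideanSpace ℝ (Fin d) × EuclideanSpace ℝ (Fin d))}

/-- The regularized transport cost of a coupling. -/
noncomputable def couplingCost (ε : ℝ) (μ ν : Measure (EuclideanSpace ℝ (Fin d)))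
    (γ : Measure (EuclideanSpace ℝ (Fin d) × EuclideanSpace ℝ (Fin d))) : ℝ≥0∞ :=
  (∫⁻ p, (sqDistCost p.1 p.2 : ℝ≥0∞) ∂γ) +
    ENNReal.ofReal ε * InformationTheory.klDiv γ (μ.prod ν)

lemma isProbabilityMeasure_gaussianDist (hS : S.PosDef) :
    IsProbabilityMeasure (gaussianDist m S) := by
  rw [gaussianDist_eq_multivariateGaussian m hS]
  infer_instance

lemma coe_sqDistCost (x y : EuclideanSpace ℝ (Fin d)) :
    (sqDistCost x y : ℝ≥0∞) = ENNReal.ofReal (‖x - y‖ ^ 2) := by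
  rw [ENNReal.ofReal, sqDistCost, ← norm_toNNReal, Real.toNNReal_pow (norm_nonneg _)]

lemma integrable_norm_sub_sq (h : ∫⁻ p, (sqDistCost p.1 p.2 : ℝ≥0∞) ∂γ ≠ ∞) :
    Integrable (fun p ↦ ‖p.1 - p.2‖ ^ 2) γ := by
  simp only [coe_sqDistCost] at h
  exact (lintegral_ofReal_ne_top_iff_integrable (by fun_prop)
    (Filter.Eventually.of_forall fun p ↦ by positivity)).1 h

lemma toReal_lintegral_sqDistCost :
    (∫⁻ p, (sqDistCost p.1 p.2 : ℝ≥0∞) ∂γ).toReal = ∫ p, ‖p.1 - p.2‖ ^ 2 ∂γ := by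
  rw [integral_eq_lintegral_of_nonneg_ae (Filter.Eventually.of_forall fun p ↦ by positivity)
    (by fun_prop)]
  simp only [coe_sqDistCost]

lemma IsCoupling.isProbabilityMeasure [IsProbabilityMeasure P]
    {P' : Measure (EuclideanSpace ℝ (Fin d))} (hγ : IsCoupling P' P γ) :
    IsProbabilityMeasure γ := by
  refine ⟨?_⟩
  have : P Set.univ = 1 := measure_univ
  rwa [← hγ.2, Measure.map_apply measurable_snd .univ, Set.preimage_univ] at this

/-- Write `y = x - (x - y)`: the first term has finitely supported law, the second is square
integrable by finiteness of the transport cost. -/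
lemma memLp_two_of_isCoupling (hn : 1 ≤ n) (hγ : IsCoupling (empiricalMeasure ξ) P γ)
    (hfin : ∫⁻ p, (sqDistCost p.1 p.2 : ℝ≥0∞) ∂γ ≠ ∞) : MemLp id 2 P := by
  have h1 : MemLp (fun p : EuclideanSpace ℝ (Fin d) × EuclideanSpace ℝ (Fin d) ↦ p.1 - p.2) 2 γ :=
    (memLp_two_iff_integrable_sq_norm (by fun_prop)).2 (integrable_norm_sub_sq hfin)
  have h2 : MemLp (id : EuclideanSpace ℝ (Fin d) → _) 2 (empiricalMeasure ξ) := by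
    refine (memLp_two_iff_integrable_sq_norm (by fun_prop)).2 ?_
    exact integrable_empiricalMeasure hn ξ (by fun_prop)
  have h3 : MemLp (fun p : EuclideanSpace ℝ (Fin d) × EuclideanSpace ℝ (Fin d) ↦ p.1) 2 γ := by
    rw [← hγ.1] at h2
    exact (memLp_map_measure_iff (g := id) (by fun_prop) measurable_fst.aemeasurable).1 h2
  rw [← hγ.2, memLp_map_measure_iff (by fun_prop) (by fun_prop)]
  have h4 := h3.sub h1
  rwa [show (fun p : EuclideanSpace ℝ (Fin d) × EuclideanSpace ℝ (Fin d) ↦ p.1) -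
    (fun p ↦ p.1 - p.2) = id ∘ Prod.snd from funext fun p ↦ by simp] at h4

lemma lintegral_exp_gibbsExponent (hn : 1 ≤ n) (hε : 0 < ε) (hS : S.PosDef)
    (ht : (tiltMatrix ε S Q t).PosDef) (ξ : Fin n → EuclideanSpace ℝ (Fin d)) :
    ∫⁻ p, ENNReal.ofReal (Real.exp (gibbsExponent ε m S Q q t p))
      ∂((empiricalMeasure ξ).prod (gaussianDist m S)) = 1 := by
  have := isProbabilityMeasure_gaussianDist (m := m) hS
  have := isProbabilityMeasure_empiricalMeasure hn ξ
  have hm : Measurable fun p ↦ ENNReal.ofReal (Real.exp (gibbsExponent ε m S Q q t p)) :=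
    (Real.continuous_exp.comp continuous_gibbsExponent).measurable.ennreal_ofReal
  rw [lintegral_prod _ hm.aemeasurable]
  have h : ∀ x, ∫⁻ y, ENNReal.ofReal (Real.exp (gibbsExponent ε m S Q q t (x, y)))
      ∂(gaussianDist m S) = 1 := fun x ↦ by
    rw [← setLIntegral_univ, ← withDensity_apply _ .univ,
      gaussianDist_withDensity_exp_gibbsExponent hε hS ht, measure_univ]
  simp [h]

/-- Weak duality for a single coupling. -/
lemma mul_integral_quadLoss_le (hn : 1 ≤ n) (hε : 0 < ε) (hS : S.PosDef)
    (ht : (tiltMatrix ε S Q t).PosDef) [IsProbabilityMeasure P]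
    (hγ : IsCoupling (empiricalMeasure ξ) P γ)
    (hfin : couplingCost ε (empiricalMeasure ξ) (gaussianDist m S) γ ≠ ∞) :
    t * ∫ z, quadLoss Q q z ∂P ≤
      (couplingCost ε (empiricalMeasure ξ) (gaussianDist m S) γ).toReal +
        1 / (n : ℝ) * ∑ i, logPartition ε m S Q q t (ξ i) := by
  have := isProbabilityMeasure_gaussianDist (m := m) hS
  have := isProbabilityMeasure_empiricalMeasure hn ξ
  have := hγ.isProbabilityMeasure
  obtain ⟨hc, hk⟩ := ENNReal.add_ne_top.1 hfin
  have hkl : InformationTheory.klDiv γ ((empiricalMeasure ξ).prod (gaussianDist m S)) ≠ ∞ := by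
    intro h
    rw [h, ENNReal.mul_top (by simpa using hε)] at hk
    exact hk rfl
  have hP := memLp_two_of_isCoupling hn hγ hc
  have i1 : Integrable (fun p ↦ quadLoss Q q p.2) γ := by
    have := integrable_quadLoss hP Q q
    rw [← hγ.2] at this
    exact this.comp_measurable measurable_snd
  have e1 : ∫ p, quadLoss Q q p.2 ∂γ = ∫ z, quadLoss Q q z ∂P := by
    rw [← hγ.2, integral_map (by fun_prop) continuous_quadLoss.aestronglyMeasurable]
  have hsm := (continuous_logPartition (ε := ε) (m := m) (S := S) (Q := Q) (q := q)
    (t := t)).stronglyMeasurable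
  have i2 : Integrable (fun p ↦ logPartition ε m S Q q t p.1) γ := by
    have := integrable_empiricalMeasure hn ξ hsm
    rw [← hγ.1] at this
    exact this.comp_measurable measurable_fst
  have e2 : ∫ p, logPartition ε m S Q q t p.1 ∂γ =
      1 / (n : ℝ) * ∑ i, logPartition ε m S Q q t (ξ i) := by
    rw [← integral_empiricalMeasure ξ hsm, ← hγ.1,
      integral_map (by fun_prop) hsm.aestronglyMeasurable]
  have i3 := integrable_norm_sub_sq hc
  have i12 : Integrable (fun p ↦ t * quadLoss Q q p.2 - ‖p.1 - p.2‖ ^ 2) γ :=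
    (i1.const_mul t).sub i3
  have hgi : Integrable (gibbsExponent ε m S Q q t) γ := (i12.sub i2).div_const ε
  -- Multiplied by `ε`, this is the claim with the transport cost moved to the left-hand side.
  have hle := integral_le_toReal_klDiv continuous_gibbsExponent.measurable
    (lintegral_exp_gibbsExponent hn hε hS ht ξ) hgi hkl
  have hval : ∫ p, gibbsExponent ε m S Q q t p ∂γ =
      (t * ∫ z, quadLoss Q q z ∂P - ∫ p, ‖p.1 - p.2‖ ^ 2 ∂γ -
        1 / (n : ℝ) * ∑ i, logPartition ε m S Q q t (ξ i)) / ε := by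
    simp only [gibbsExponent]
    rw [integral_div, integral_sub i12 i2, integral_sub (i1.const_mul t) i3, integral_const_mul,
      e1, e2]
  rw [hval, div_le_iff₀ hε] at hle
  rw [couplingCost, ENNReal.toReal_add hc hk, ENNReal.toReal_mul, ENNReal.toReal_ofReal hε.le,
    toReal_lintegral_sqDistCost]
  linarith

end Weak

/-! ### The Gibbs coupling: marginals, cost and risk -/

section GibbsCoupling

variable {d n : ℕ} {ε : ℝ} {m : EuclideanSpace ℝ (Fin d)} {S Q : Matrix (Fin d) (Fin d) ℝ}
  {q : EuclideanSpace ℝ (Fin d)} {t : ℝ} {ξ : Fin n → EuclideanSpace ℝ (Fin d)}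

/-- The coupling that maximizes the penalized risk with multiplier `1 / t`. -/
noncomputable def gibbsCoupling (ε : ℝ) (m : EuclideanSpace ℝ (Fin d))
    (S Q : Matrix (Fin d) (Fin d) ℝ) (q : EuclideanSpace ℝ (Fin d)) (t : ℝ)
    (ξ : Fin n → EuclideanSpace ℝ (Fin d)) :
    Measure (EuclideanSpace ℝ (Fin d) × EuclideanSpace ℝ (Fin d)) :=
  ((empiricalMeasure ξ).prod (gaussianDist m S)).withDensity
    fun p ↦ ENNReal.ofReal (Real.exp (gibbsExponent ε m S Q q t p))

/-- The expected loss under the second marginal of the Gibbs coupling. -/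
noncomputable def gibbsRisk (ε : ℝ) (m : EuclideanSpace ℝ (Fin d))
    (S Q : Matrix (Fin d) (Fin d) ℝ) (q : EuclideanSpace ℝ (Fin d))
    (ξ : Fin n → EuclideanSpace ℝ (Fin d)) (t : ℝ) : ℝ :=
  1 / (n : ℝ) * ∑ i, tiltRisk ε m S Q q t (ξ i)

/-- The average of `logPartition` over the samples. -/
noncomputable def meanLogPartition (ε : ℝ) (m : EuclideanSpace ℝ (Fin d))
    (S Q : Matrix (Fin d) (Fin d) ℝ) (q : EuclideanSpace ℝ (Fin d))
    (ξ : Fin n → EuclideanSpace ℝ (Fin d)) (t : ℝ) : ℝ :=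
  1 / (n : ℝ) * ∑ i, logPartition ε m S Q q t (ξ i)

/-- The regularized transport cost of the Gibbs coupling. -/
noncomputable def gibbsCost (ε : ℝ) (m : EuclideanSpace ℝ (Fin d))
    (S Q : Matrix (Fin d) (Fin d) ℝ) (q : EuclideanSpace ℝ (Fin d))
    (ξ : Fin n → EuclideanSpace ℝ (Fin d)) (t : ℝ) : ℝ :=
  t * gibbsRisk ε m S Q q ξ t - meanLogPartition ε m S Q q ξ t

open ProbabilityTheory in
-- The density is normalized separately for each first coordinate, so the coupling disintegrates
-- over the samples into tilted Gaussians. All integrals thereby reduce to Gaussian moments.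
lemma gibbsCoupling_eq_sum (hε : 0 < ε) (hS : S.PosDef) (ht : (tiltMatrix ε S Q t).PosDef) :
    gibbsCoupling ε m S Q q t ξ = (n : ℝ≥0∞)⁻¹ • ∑ i,
      (multivariateGaussian (tiltMean ε m S Q q (ξ i) t)
        ((ε / 2) • (tiltMatrix ε S Q t)⁻¹)).map (Prod.mk (ξ i)) := by
  have := isProbabilityMeasure_gaussianDist (m := m) hS
  have hm : Measurable fun p ↦ ENNReal.ofReal (Real.exp (gibbsExponent ε m S Q q t p)) :=
    (Real.continuous_exp.comp continuous_gibbsExponent).measurable.ennreal_ofReal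
  ext s hs
  have hms := hm.indicator hs
  rw [gibbsCoupling, withDensity_apply _ hs, ← lintegral_indicator hs,
    lintegral_prod _ hms.aemeasurable, lintegral_empiricalMeasure ξ hms.lintegral_prod_right',
    Measure.smul_apply, Measure.finsetSum_apply, smul_eq_mul]
  congr 1
  refine Finset.sum_congr rfl fun i _ ↦ ?_
  rw [Measure.map_apply measurable_prodMk_left hs,
    ← gaussianDist_withDensity_exp_gibbsExponent hε hS ht,
    withDensity_apply _ (measurable_prodMk_left hs), ← lintegral_indicator
    (measurable_prodMk_left hs)]
  rfl

lemma map_fst_gibbsCoupling (hε : 0 < ε) (hS : S.PosDef) (ht : (tiltMatrix ε S Q t).PosDef) :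
    (gibbsCoupling ε m S Q q t ξ).map Prod.fst = empiricalMeasure ξ := by
  rw [gibbsCoupling_eq_sum hε hS ht, empiricalMeasure]
  ext s hs
  rw [Measure.map_apply measurable_fst hs, Measure.smul_apply, Measure.smul_apply,
    Measure.finsetSum_apply, Measure.finsetSum_apply]
  congr 1
  refine Finset.sum_congr rfl fun i _ ↦ ?_
  rw [Measure.map_apply measurable_prodMk_left (measurable_fst hs), Measure.dirac_apply' _ hs]
  by_cases h : ξ i ∈ s
  · have : Prod.mk (ξ i) ⁻¹' (Prod.fst ⁻¹' s) =
      (Set.univ : Set (EuclideanSpace ℝ (Fin d))) := by ext; simp [h]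
    simp [this, h]
  · have : Prod.mk (ξ i) ⁻¹' (Prod.fst ⁻¹' s) =
      (∅ : Set (EuclideanSpace ℝ (Fin d))) := by ext; simp [h]
    simp [this, h]

open ProbabilityTheory in
lemma integrable_gibbsCoupling (hn : 1 ≤ n) (hε : 0 < ε) (hS : S.PosDef)
    (ht : (tiltMatrix ε S Q t).PosDef)
    {g : EuclideanSpace ℝ (Fin d) × EuclideanSpace ℝ (Fin d) → ℝ} (hg : Continuous g)
    (hgi : ∀ i, Integrable (fun y ↦ g (ξ i, y)) (multivariateGaussian
      (tiltMean ε m S Q q (ξ i) t) ((ε / 2) • (tiltMatrix ε S Q t)⁻¹))) :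
    Integrable g (gibbsCoupling ε m S Q q t ξ) ∧
      ∫ p, g p ∂(gibbsCoupling ε m S Q q t ξ) = 1 / (n : ℝ) * ∑ i, ∫ y, g (ξ i, y)
        ∂(multivariateGaussian (tiltMean ε m S Q q (ξ i) t)
          ((ε / 2) • (tiltMatrix ε S Q t)⁻¹)) := by
  have h0 : (n : ℝ≥0∞) ≠ 0 := by exact_mod_cast (by lia : n ≠ 0)
  have hi : ∀ i ∈ Finset.univ, Integrable g ((multivariateGaussian (tiltMean ε m S Q q (ξ i) t)
      ((ε / 2) • (tiltMatrix ε S Q t)⁻¹)).map (Prod.mk (ξ i))) := fun i _ ↦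
    (integrable_map_measure hg.aestronglyMeasurable measurable_prodMk_left.aemeasurable).2 (hgi i)
  rw [gibbsCoupling_eq_sum hε hS ht]
  refine ⟨(integrable_finsetSum_measure.2 hi).smul_measure (ENNReal.inv_ne_top.2 h0), ?_⟩
  rw [integral_smul_measure, integral_finsetSum_measure hi]
  simp only [ENNReal.toReal_inv, ENNReal.toReal_natCast, one_div, smul_eq_mul]
  congr 1
  refine Finset.sum_congr rfl fun i _ ↦ ?_
  rw [integral_map measurable_prodMk_left.aemeasurable hg.aestronglyMeasurable]

open ProbabilityTheory in
/-- The Gibbs coupling has the announced marginal, cost and risk. -/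
lemma gibbsCoupling_spec (hn : 1 ≤ n) (hε : 0 < ε) (hS : S.PosDef)
    (ht : (tiltMatrix ε S Q t).PosDef) :
    ∃ P, IsProbabilityMeasure P ∧
      IsCoupling (empiricalMeasure ξ) P (gibbsCoupling ε m S Q q t ξ) ∧
      couplingCost ε (empiricalMeasure ξ) (gaussianDist m S) (gibbsCoupling ε m S Q q t ξ) =
        ENNReal.ofReal (gibbsCost ε m S Q q ξ t) ∧
      ∫ z, quadLoss Q q z ∂P = gibbsRisk ε m S Q q ξ t ∧
      ε / 2 * (tiltMatrix ε S Q t)⁻¹.trace ≤ gibbsCost ε m S Q q ξ t := by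
  have := isProbabilityMeasure_gaussianDist (m := m) hS
  have := isProbabilityMeasure_empiricalMeasure hn ξ
  have hn0 : (0 : ℝ) < n := by exact_mod_cast hn
  have hV := (posDef_smul_inv hε ht).posSemidef
  set γ := gibbsCoupling ε m S Q q t ξ with hγ
  have hfst : γ.map Prod.fst = empiricalMeasure ξ := map_fst_gibbsCoupling hε hS ht
  have hγp : IsProbabilityMeasure γ := ⟨by
    rw [hγ, gibbsCoupling, withDensity_apply _ .univ, setLIntegral_univ,
      lintegral_exp_gibbsExponent hn hε hS ht]⟩
  have hmem : ∀ i, MemLp id 2 (multivariateGaussian (tiltMean ε m S Q q (ξ i) t)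
      ((ε / 2) • (tiltMatrix ε S Q t)⁻¹)) := fun i ↦ IsGaussian.memLp_two_id
  have hcl := continuous_quadLoss (Q := Q) (q := q)
  have hcp := continuous_logPartition (ε := ε) (m := m) (S := S) (Q := Q) (q := q) (t := t)
  obtain ⟨i1, e1⟩ := integrable_gibbsCoupling hn hε hS ht (ξ := ξ) (m := m) (q := q)
    (g := fun p ↦ quadLoss Q q p.2) (by fun_prop) (fun i ↦ integrable_quadLoss (hmem i) Q q)
  obtain ⟨i2, e2⟩ := integrable_gibbsCoupling hn hε hS ht (ξ := ξ) (m := m) (q := q)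
    (g := fun p ↦ ‖p.1 - p.2‖ ^ 2) (by fun_prop) (fun i ↦ by
      simp only [norm_sub_sq_eq_quadLoss]
      exact (integrable_quadLoss (hmem i) _ _).add (integrable_const _))
  obtain ⟨i3, e3⟩ := integrable_gibbsCoupling hn hε hS ht (ξ := ξ) (m := m) (q := q)
    (g := fun p ↦ logPartition ε m S Q q t p.1) (by fun_prop)
    (fun i ↦ integrable_const (logPartition ε m S Q q t (ξ i)))
  rw [← hγ] at i1 e1 i2 e2 i3 e3
  have e1' : ∫ p, quadLoss Q q p.2 ∂γ = gibbsRisk ε m S Q q ξ t := by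
    rw [e1]
    simp only [integral_quadLoss_multivariateGaussian hV]
    rfl
  have e3' : ∫ p, logPartition ε m S Q q t p.1 ∂γ = meanLogPartition ε m S Q q ξ t := by
    rw [e3]
    simp [meanLogPartition]
  -- The mean squared distance from `ξ i` is the trace of the covariance plus the squared distance
  -- to the mean; the latter is dropped.
  have hcost : ε / 2 * (tiltMatrix ε S Q t)⁻¹.trace ≤ ∫ p, ‖p.1 - p.2‖ ^ 2 ∂γ := by
    rw [e2]
    have hi : ∀ i, ε / 2 * (tiltMatrix ε S Q t)⁻¹.trace ≤ ∫ y, ‖ξ i - y‖ ^ 2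
        ∂(multivariateGaussian (tiltMean ε m S Q q (ξ i) t)
          ((ε / 2) • (tiltMatrix ε S Q t)⁻¹)) := fun i ↦ by
      simp only [norm_sub_sq_eq_quadLoss]
      rw [integral_add (integrable_quadLoss (hmem i) _ _) (integrable_const _),
        integral_quadLoss_multivariateGaussian hV, integral_const, Matrix.one_mul, trace_smul]
      have := sq_nonneg ‖ξ i - tiltMean ε m S Q q (ξ i) t‖
      rw [norm_sub_sq_eq_quadLoss] at this
      simp only [smul_eq_mul, probReal_univ, one_mul]
      linarith
    have hsum := Finset.sum_le_sum fun i (_ : i ∈ Finset.univ) ↦ hi i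
    rw [Finset.sum_const, Finset.card_univ, Fintype.card_fin, nsmul_eq_mul] at hsum
    rw [one_div, inv_mul_eq_div, le_div_iff₀ hn0, mul_comm]
    exact hsum
  have i12 : Integrable (fun p ↦ t * quadLoss Q q p.2 - ‖p.1 - p.2‖ ^ 2) γ :=
    (i1.const_mul t).sub i2
  have hgi : Integrable (gibbsExponent ε m S Q q t) γ := (i12.sub i3).div_const ε
  have hval : ∫ p, gibbsExponent ε m S Q q t p ∂γ =
      (gibbsCost ε m S Q q ξ t - ∫ p, ‖p.1 - p.2‖ ^ 2 ∂γ) / ε := by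
    simp only [gibbsExponent]
    rw [integral_div, integral_sub i12 i3, integral_sub (i1.const_mul t) i2, integral_const_mul,
      e1', e3', gibbsCost]
    ring
  obtain ⟨hkl0, hkl⟩ := klDiv_withDensity_exp continuous_gibbsExponent.measurable
    (lintegral_exp_gibbsExponent hn hε hS ht ξ) hgi
  rw [← gibbsCoupling, ← hγ, hval] at hkl hkl0
  refine ⟨γ.map Prod.snd, Measure.isProbabilityMeasure_map measurable_snd.aemeasurable,
    ⟨hfst, rfl⟩, ?_, ?_, ?_⟩
  · have hc : ∫⁻ p, (sqDistCost p.1 p.2 : ℝ≥0∞) ∂γ =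
        ENNReal.ofReal (∫ p, ‖p.1 - p.2‖ ^ 2 ∂γ) := by
      simp only [coe_sqDistCost]
      rw [ofReal_integral_eq_lintegral_ofReal i2 (Filter.Eventually.of_forall fun p ↦ by positivity)]
    rw [couplingCost, hc, hkl, ← ENNReal.ofReal_mul hε.le, ← ENNReal.ofReal_add
      (integral_nonneg fun p ↦ by positivity) (by positivity)]
    congr 1
    field_simp
    ring
  · rw [integral_map measurable_snd.aemeasurable hcl.aestronglyMeasurable, e1']
  -- The entropy is nonnegative, so the regularized cost dominates the transport cost bounded in
  -- `hcost`.
  · have := (div_nonneg_iff.1 hkl0).resolve_right (fun h ↦ by linarith [h.2])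
    linarith [this.1]

end GibbsCoupling

/-! ### Weak duality over the ball and feasibility -/

section Duality

variable {d n : ℕ} {ε ρ : ℝ} {m : EuclideanSpace ℝ (Fin d)} {S Q : Matrix (Fin d) (Fin d) ℝ}
  {q : EuclideanSpace ℝ (Fin d)} {t : ℝ} {ξ : Fin n → EuclideanSpace ℝ (Fin d)}
  {P : Measure (EuclideanSpace ℝ (Fin d))}

/-- The slack `δ` avoids having to know that the infimum over couplings is attained. -/
lemma exists_coupling_of_mem_sinkhornBall (hρ : 0 ≤ ρ)
    (hP : P ∈ sinkhornBall sqDistCost ε ρ (gaussianDist m S) (empiricalMeasure ξ))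
    {δ : ℝ} (hδ : 0 < δ) :
    ∃ γ, IsCoupling (empiricalMeasure ξ) P γ ∧
      couplingCost ε (empiricalMeasure ξ) (gaussianDist m S) γ ≠ ∞ ∧
      (couplingCost ε (empiricalMeasure ξ) (gaussianDist m S) γ).toReal ≤ ρ + δ := by
  have hlt : sinkhornDiscrepancy sqDistCost ε (empiricalMeasure ξ) (gaussianDist m S)
      (empiricalMeasure ξ) P < ENNReal.ofReal (ρ + δ) :=
    hP.2.trans_lt ((ENNReal.ofReal_lt_ofReal_iff (by linarith)).2 (by linarith))
  simp only [sinkhornDiscrepancy, iInf_lt_iff] at hlt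
  obtain ⟨γ, hγ, hlt⟩ := hlt
  exact ⟨γ, hγ, hlt.ne_top, ENNReal.toReal_le_of_le_ofReal (by linarith) hlt.le⟩

lemma memLp_two_of_mem_sinkhornBall (hn : 1 ≤ n) (hρ : 0 ≤ ρ)
    (hP : P ∈ sinkhornBall sqDistCost ε ρ (gaussianDist m S) (empiricalMeasure ξ)) :
    MemLp id 2 P := by
  obtain ⟨γ, hγ, hfin, -⟩ := exists_coupling_of_mem_sinkhornBall hρ hP one_pos
  exact memLp_two_of_isCoupling hn hγ (ENNReal.add_ne_top.1 hfin).1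

lemma mul_integral_quadLoss_le_of_mem_sinkhornBall (hn : 1 ≤ n) (hε : 0 < ε) (hρ : 0 ≤ ρ)
    (hS : S.PosDef) (ht : (tiltMatrix ε S Q t).PosDef)
    (hP : P ∈ sinkhornBall sqDistCost ε ρ (gaussianDist m S) (empiricalMeasure ξ)) :
    t * ∫ z, quadLoss Q q z ∂P ≤ ρ + meanLogPartition ε m S Q q ξ t := by
  have := hP.1
  refine le_of_forall_pos_le_add fun δ hδ ↦ ?_
  obtain ⟨γ, hγ, hfin, hle⟩ := exists_coupling_of_mem_sinkhornBall hρ hP hδ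
  have := mul_integral_quadLoss_le (q := q) hn hε hS ht hγ hfin
  rw [← meanLogPartition] at this
  linarith

lemma gibbsCost_nonneg (hn : 1 ≤ n) (hε : 0 < ε) (hS : S.PosDef)
    (ht : (tiltMatrix ε S Q t).PosDef) : 0 ≤ gibbsCost ε m S Q q ξ t := by
  obtain ⟨-, -, -, -, -, h⟩ := gibbsCoupling_spec (m := m) (q := q) (ξ := ξ) hn hε hS ht
  have := ht.inv.posSemidef.trace_nonneg
  exact (by positivity : 0 ≤ ε / 2 * (tiltMatrix ε S Q t)⁻¹.trace).trans h

/-- Weak duality at parameter `s`, tested on the Gibbs coupling at `t`. The case `s = 0` says `c(0)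
≤ c(t)`; general `s` yields convexity of the dual. -/
lemma mul_gibbsRisk_le (hn : 1 ≤ n) (hε : 0 < ε) (hS : S.PosDef)
    (ht : (tiltMatrix ε S Q t).PosDef) {s : ℝ} (hs : (tiltMatrix ε S Q s).PosDef) :
    s * gibbsRisk ε m S Q q ξ t ≤
      gibbsCost ε m S Q q ξ t + meanLogPartition ε m S Q q ξ s := by
  obtain ⟨P, hP, hγ, hcost, hrisk, -⟩ :=
    gibbsCoupling_spec (m := m) (q := q) (ξ := ξ) hn hε hS ht
  have h := mul_integral_quadLoss_le (q := q) hn hε hS hs hγ (by rw [hcost]; simp)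
  rwa [hcost, ENNReal.toReal_ofReal (gibbsCost_nonneg hn hε hS ht), hrisk] at h

lemma exists_mem_sinkhornBall (hn : 1 ≤ n) (hε : 0 < ε) (hS : S.PosDef)
    (ht : (tiltMatrix ε S Q t).PosDef) (hle : gibbsCost ε m S Q q ξ t ≤ ρ) :
    ∃ P ∈ sinkhornBall sqDistCost ε ρ (gaussianDist m S) (empiricalMeasure ξ),
      ∫ z, quadLoss Q q z ∂P = gibbsRisk ε m S Q q ξ t := by
  obtain ⟨P, hP, hγ, hcost, hrisk, -⟩ :=
    gibbsCoupling_spec (m := m) (q := q) (ξ := ξ) hn hε hS ht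
  refine ⟨P, ⟨hP, ?_⟩, hrisk⟩
  exact (iInf₂_le _ hγ).trans (hcost.trans_le (ENNReal.ofReal_le_ofReal hle))

lemma criticalRadius_eq_gibbsCost (hn : 1 ≤ n) (hε : 0 < ε) (hS : S.PosDef) :
    criticalRadius ε m S ξ = gibbsCost ε m S Q q ξ 0 := by
  rw [criticalRadius_eq (Q := Q) (q := q) hn hε hS, gibbsCost, meanLogPartition]
  ring

/-- Weak duality at `t = 0` bounds every cost below by `c(0)`, and the Gibbs coupling at `0` attains
it. No loss is involved, hence the choice `Q = 0`, `q = 0`. -/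
lemma nonempty_sinkhornBall_iff (hn : 1 ≤ n) (hε : 0 < ε) (hρ : 0 ≤ ρ) (hS : S.PosDef) :
    (sinkhornBall sqDistCost ε ρ (gaussianDist m S) (empiricalMeasure ξ)).Nonempty ↔
      criticalRadius ε m S ξ ≤ ρ := by
  have h0 := tiltMatrix_zero_posDef (Q := 0) hε hS
  rw [criticalRadius_eq_gibbsCost (Q := 0) (q := 0) hn hε hS]
  refine ⟨fun ⟨P, hP⟩ ↦ ?_, fun h ↦ ?_⟩
  · have := mul_integral_quadLoss_le_of_mem_sinkhornBall (q := 0) hn hε hρ hS h0 hP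
    rw [gibbsCost]
    linarith
  · obtain ⟨P, hP, -⟩ := exists_mem_sinkhornBall hn hε hS h0 h
    exact ⟨P, hP⟩

/-! ### Convexity of the dual program -/

/-- `M_0 = -Q` has nonpositive diagonal. Hence `λ = 0`, where `t = 1/λ` is meaningless, is feasible
only in dimension zero. -/
lemma eq_zero_of_dualMatrix_zero_posDef (hQ : Q.PosSemidef) (h : (dualMatrix ε S Q 0).PosDef) :
    d = 0 := by
  by_contra hd
  have : NeZero d := ⟨hd⟩
  have h1 := h.diag_pos (i := (0 : Fin d))
  have h2 := hQ.diag_nonneg (i := (0 : Fin d))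
  simp only [dualMatrix, zero_smul, zero_sub, Matrix.neg_apply] at h1
  linarith

lemma epigraphFun_of_dim_zero (hd : d = 0) (x : EuclideanSpace ℝ (Fin d)) (lam : ℝ) :
    epigraphFun ε m S Q q x lam = 0 := by
  subst hd
  have : x = 0 := Subsingleton.elim _ _
  simp [epigraphFun, quadForm, this]

lemma dualMatrix_convexComb_posDef {a b lam₁ lam₂ : ℝ} (ha : 0 ≤ a) (hb : 0 ≤ b) (hab : a + b = 1)
    (h₁ : (dualMatrix ε S Q lam₁).PosDef) (h₂ : (dualMatrix ε S Q lam₂).PosDef) :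
    (dualMatrix ε S Q (a * lam₁ + b * lam₂)).PosDef := by
  have heq : dualMatrix ε S Q (a * lam₁ + b * lam₂) =
      a • dualMatrix ε S Q lam₁ + b • dualMatrix ε S Q lam₂ := by
    have : Q = a • Q + b • Q := by rw [← add_smul, hab, one_smul]
    simp only [dualMatrix, smul_sub a, smul_sub b, smul_smul, add_smul]
    nth_rw 1 [this]
    abel
  rw [heq]
  rcases ha.eq_or_lt with rfl | ha
  · rw [zero_add] at hab
    simpa [hab] using h₂
  · exact (h₁.smul ha).add_posSemidef (h₂.posSemidef.smul hb)

/-- The multiplier enters the dual constraint in a convex way: `epigraphFun` is a supremum of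
affine functions. -/
lemma epigraphFun_convexComb_le (hε : 0 < ε) (hS : S.PosDef) (hQ : Q.PosSemidef)
    {a b lam₁ lam₂ : ℝ} (ha : 0 ≤ a) (hb : 0 ≤ b) (hab : a + b = 1)
    (hl₁ : 0 ≤ lam₁) (hl₂ : 0 ≤ lam₂)
    (h₁ : (dualMatrix ε S Q lam₁).PosDef) (h₂ : (dualMatrix ε S Q lam₂).PosDef)
    (x : EuclideanSpace ℝ (Fin d)) :
    epigraphFun ε m S Q q x (a * lam₁ + b * lam₂) ≤
      a * epigraphFun ε m S Q q x lam₁ + b * epigraphFun ε m S Q q x lam₂ := by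
  by_cases hd : d = 0
  · simp [epigraphFun_of_dim_zero hd]
  have hpos : ∀ lam : ℝ, 0 ≤ lam → (dualMatrix ε S Q lam).PosDef → 0 < lam := by
    intro lam hl h
    refine hl.lt_of_ne fun h0 ↦ hd ?_
    rw [← h0] at h
    exact eq_zero_of_dualMatrix_zero_posDef hQ h
  have h := dualMatrix_convexComb_posDef ha hb hab h₁ h₂
  have hl := hpos _ (by positivity) h
  replace hl₁ := hpos _ hl₁ h₁
  replace hl₂ := hpos _ hl₂ h₂
  have ht := (dualMatrix_posDef_iff hl).1 h
  set lam := a * lam₁ + b * lam₂ with hlam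
  -- The Gibbs coupling for the single sample `x` supplies the supporting line `l ↦ R - l * c`,
  -- which touches `epigraphFun` at `lam`.
  set R := gibbsRisk ε m S Q q (fun _ : Fin 1 ↦ x) lam⁻¹ with hR
  set c := gibbsCost ε m S Q q (fun _ : Fin 1 ↦ x) lam⁻¹ with hc
  have hmean : ∀ s, meanLogPartition ε m S Q q (fun _ : Fin 1 ↦ x) s =
      logPartition ε m S Q q s x := fun s ↦ by simp [meanLogPartition]
  have hle : ∀ l : ℝ, 0 < l → (dualMatrix ε S Q l).PosDef →
      R - l * c ≤ epigraphFun ε m S Q q x l := by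
    intro l hl0 hpd
    have hs := (dualMatrix_posDef_iff hl0).1 hpd
    have h := mul_gibbsRisk_le (m := m) (q := q) (ξ := fun _ : Fin 1 ↦ x) le_rfl hε hS ht hs
    rw [← hR, ← hc, hmean] at h
    have h' := mul_le_mul_of_nonneg_left h hl0.le
    rw [mul_inv_cancel_left₀ hl0.ne', mul_add] at h'
    rw [epigraphFun_eq hε hl0 hs]
    linarith
  have heq : epigraphFun ε m S Q q x lam = R - lam * c := by
    rw [epigraphFun_eq hε hl ht, hc, gibbsCost, hmean, ← hR, mul_sub,
      mul_inv_cancel_left₀ hl.ne']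
    ring
  have e₁ := mul_le_mul_of_nonneg_left (hle _ hl₁ h₁) ha
  have e₂ := mul_le_mul_of_nonneg_left (hle _ hl₂ h₂) hb
  have e₃ : R = a * R + b * R := by rw [← add_mul, hab, one_mul]
  rw [heq, hlam]
  linarith

lemma convexOn_dualObjective (hε : 0 < ε) (hS : S.PosDef) (hQ : Q.PosSemidef) :
    ConvexOn ℝ (dualFeasible ε m S Q q ξ) (dualObjective ρ) := by
  refine ⟨fun p₁ h₁ p₂ h₂ a b ha hb hab ↦ ⟨?_, ?_, fun i ↦ ?_⟩,
    fun p₁ h₁ p₂ h₂ a b ha hb hab ↦ le_of_eq ?_⟩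
  · have := h₁.1
    have := h₂.1
    simp only [Prod.fst_add, Prod.smul_fst, smul_eq_mul]
    positivity
  · exact dualMatrix_convexComb_posDef ha hb hab h₁.2.1 h₂.2.1
  · refine (epigraphFun_convexComb_le hε hS hQ ha hb hab h₁.1 h₂.1 h₁.2.1 h₂.2.1 (ξ i)).trans ?_
    simp only [Prod.snd_add, Prod.smul_snd, Pi.add_apply, Pi.smul_apply, smul_eq_mul]
    exact add_le_add (mul_le_mul_of_nonneg_left (h₁.2.2 i) ha)
      (mul_le_mul_of_nonneg_left (h₂.2.2 i) hb)
  · simp only [dualObjective, Prod.fst_add, Prod.smul_fst, Prod.snd_add, Prod.smul_snd,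
      Pi.add_apply, Pi.smul_apply, smul_eq_mul, Finset.sum_add_distrib, ← Finset.mul_sum]
    ring

/-! ### Equality of the primal and dual values -/

lemma worstCaseRisk_le_dualValue (hn : 1 ≤ n) (hε : 0 < ε) (hρ : 0 ≤ ρ) (hS : S.PosDef)
    (hQ : Q.PosSemidef) :
    worstCaseRisk (sinkhornBall sqDistCost ε ρ (gaussianDist m S) (empiricalMeasure ξ))
      (quadLoss Q q) ≤ dualValue ε ρ m S Q q ξ := by
  refine iSup₂_le fun P hP ↦ le_iInf₂ fun p hp ↦ EReal.coe_le_coe_iff.2 ?_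
  obtain ⟨hl, hpd, hs⟩ := hp
  have hsum := Finset.sum_le_sum fun i (_ : i ∈ Finset.univ) ↦ hs i
  have hn' : (0 : ℝ) ≤ 1 / n := by positivity
  rw [dualObjective]
  rcases hl.eq_or_lt with h0 | hl
  · rw [← h0] at hpd
    have hd := eq_zero_of_dualMatrix_zero_posDef hQ hpd
    simp only [epigraphFun_of_dim_zero hd, Finset.sum_const_zero] at hsum
    have hz : ∀ z, quadLoss Q q z = 0 := fun z ↦ by
      subst hd
      simp [quadLoss, quadForm]
    simp only [hz, integral_zero, ← h0, zero_mul, zero_add]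
    positivity
  · have ht := (dualMatrix_posDef_iff hl).1 hpd
    simp only [epigraphFun_eq hε hl ht, ← Finset.mul_sum] at hsum
    have h := mul_integral_quadLoss_le_of_mem_sinkhornBall (q := q) hn hε hρ hS ht hP
    have h' := mul_le_mul_of_nonneg_left h hl.le
    rw [mul_inv_cancel_left₀ hl.ne', meanLogPartition] at h'
    have h'' := mul_le_mul_of_nonneg_left hsum hn'
    linarith

lemma dualValue_le (hε : 0 < ε) (ht0 : 0 < t) (ht : (tiltMatrix ε S Q t).PosDef) :
    dualValue ε ρ m S Q q ξ ≤ (((ρ + meanLogPartition ε m S Q q ξ t) / t : ℝ) : EReal) := by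
  have hl : 0 < t⁻¹ := inv_pos.2 ht0
  have ht' : (tiltMatrix ε S Q t⁻¹⁻¹).PosDef := by rwa [inv_inv]
  refine (iInf₂_le (t⁻¹, fun i ↦ epigraphFun ε m S Q q (ξ i) t⁻¹)
    ⟨hl.le, (dualMatrix_posDef_iff hl).2 ht', fun i ↦ le_rfl⟩).trans ?_
  refine EReal.coe_le_coe_iff.2 (le_of_eq ?_)
  simp only [dualObjective, epigraphFun_eq hε hl ht', inv_inv, ← Finset.mul_sum, meanLogPartition]
  field_simp

lemma gibbsRisk_le_worstCaseRisk (hn : 1 ≤ n) (hε : 0 < ε) (hS : S.PosDef)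
    (ht : (tiltMatrix ε S Q t).PosDef) (hle : gibbsCost ε m S Q q ξ t ≤ ρ) :
    ((gibbsRisk ε m S Q q ξ t : ℝ) : EReal) ≤
      worstCaseRisk (sinkhornBall sqDistCost ε ρ (gaussianDist m S) (empiricalMeasure ξ))
        (quadLoss Q q) := by
  obtain ⟨P, hP, hrisk⟩ := exists_mem_sinkhornBall hn hε hS ht hle
  rw [← hrisk]
  exact le_iSup₂ (f := fun P (_ : P ∈ sinkhornBall sqDistCost ε ρ (gaussianDist m S)
    (empiricalMeasure ξ)) ↦ ((∫ z, quadLoss Q q z ∂P : ℝ) : EReal)) P hP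

lemma continuousAt_meanLogPartition (ht : (tiltMatrix ε S Q t).PosDef) :
    ContinuousAt (meanLogPartition ε m S Q q ξ) t := by
  have := fun i ↦ continuousAt_logPartition (m := m) (q := q) ht (ξ i)
  unfold meanLogPartition
  fun_prop

lemma continuousAt_gibbsRisk (ht : (tiltMatrix ε S Q t).PosDef) :
    ContinuousAt (gibbsRisk ε m S Q q ξ) t := by
  have := fun i ↦ continuousAt_tiltRisk (m := m) (q := q) ht (ξ i)
  unfold gibbsRisk
  fun_prop

lemma continuousAt_gibbsCost (ht : (tiltMatrix ε S Q t).PosDef) :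
    ContinuousAt (gibbsCost ε m S Q q ξ) t := by
  have h1 := continuousAt_meanLogPartition (m := m) (q := q) (ξ := ξ) ht
  have h2 := continuousAt_gibbsRisk (m := m) (q := q) (ξ := ξ) ht
  unfold gibbsCost
  fun_prop

lemma tiltMatrix_posDef_of_le (hQ : Q.PosSemidef) (ht : (tiltMatrix ε S Q t).PosDef) {s : ℝ}
    (hs : s ≤ t) : (tiltMatrix ε S Q s).PosDef := by
  have heq : tiltMatrix ε S Q s = tiltMatrix ε S Q t + (t - s) • Q := by
    simp only [tiltMatrix, sub_smul]
    abel
  rw [heq]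
  exact ht.add_posSemidef (hQ.smul (sub_nonneg.2 hs))

lemma exists_pos_step (hQ : Q.PosSemidef) {C : ℝ} (hC : 0 ≤ C) :
    ∃ s, 0 < s ∧ C * (s * Q.trace) < 1 := by
  have h := mul_nonneg hC hQ.trace_nonneg
  refine ⟨(C * Q.trace + 1)⁻¹, by positivity, ?_⟩
  rw [mul_left_comm, inv_mul_lt_iff₀ (by positivity)]
  linarith

open Filter Topology in
lemma eventually_tiltMatrix_posDef (hε : 0 < ε) (hS : S.PosDef) (hQ : Q.PosSemidef) :
    ∀ᶠ t in 𝓝[>] (0 : ℝ), 0 < t ∧ (tiltMatrix ε S Q t).PosDef := by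
  have h0 := tiltMatrix_zero_posDef (Q := Q) hε hS
  obtain ⟨s, hs, hsC⟩ := exists_pos_step hQ h0.inv.posSemidef.trace_nonneg
  have hpd := tiltMatrix_posDef_add hQ h0 le_rfl hs.le hsC
  rw [zero_add] at hpd
  filter_upwards [Ioo_mem_nhdsGT hs] with t ht
  exact ⟨ht.1, tiltMatrix_posDef_of_le hQ hpd ht.2.le⟩

-- As `t → 0⁺`, the numerator of the dual value `(ρ + mean Λ_t)/t` tends to `ρ - c(0) < 0`.
open Filter Topology in
lemma dualValue_eq_bot_of_lt (hn : 1 ≤ n) (hε : 0 < ε) (hS : S.PosDef) (hQ : Q.PosSemidef)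
    (hlt : ρ < criticalRadius ε m S ξ) : dualValue ε ρ m S Q q ξ = ⊥ := by
  rw [criticalRadius_eq_gibbsCost (Q := Q) (q := q) hn hε hS, gibbsCost, zero_mul, zero_sub] at hlt
  have h0 := tiltMatrix_zero_posDef (Q := Q) hε hS
  have hlim : Tendsto (fun t ↦ (ρ + meanLogPartition ε m S Q q ξ t) / t) (𝓝[>] 0) atBot := by
    have h1 : Tendsto (fun t ↦ ρ + meanLogPartition ε m S Q q ξ t) (𝓝[>] 0)
        (𝓝 (ρ + meanLogPartition ε m S Q q ξ 0)) :=
      ((continuousAt_meanLogPartition h0).tendsto.mono_left nhdsWithin_le_nhds).const_add ρ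
    simp only [div_eq_mul_inv]
    exact h1.neg_mul_atTop (by linarith) tendsto_inv_nhdsGT_zero
  rw [EReal.eq_bot_iff_forall_lt]
  intro a
  obtain ⟨t, ⟨ht0, ht⟩, hta⟩ := ((eventually_tiltMatrix_posDef hε hS hQ).and
    (hlim.eventually (eventually_lt_atBot a))).exists
  exact (dualValue_le hε ht0 ht).trans_lt (EReal.coe_lt_coe_iff.2 hta)

lemma dualValue_le_gibbsRisk (hε : 0 < ε) (ht0 : 0 < t) (ht : (tiltMatrix ε S Q t).PosDef)
    (hle : ρ ≤ gibbsCost ε m S Q q ξ t) :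
    dualValue ε ρ m S Q q ξ ≤ ((gibbsRisk ε m S Q q ξ t : ℝ) : EReal) := by
  refine (dualValue_le hε ht0 ht).trans (EReal.coe_le_coe_iff.2 ?_)
  rw [gibbsCost] at hle
  rw [div_le_iff₀ ht0]
  linarith

/-- The bound `(ε/2) tr A_t⁻¹ ≤ c(t) < ρ` gives `tr A_t⁻¹ ≤ 2ρ/ε` uniformly, so positive
definiteness propagates by steps of a fixed length `s` and reaches every multiple of `s`. Smaller
parameters follow because `A_t` decreases in `t`. -/
lemma tiltMatrix_posDef_of_gibbsCost_lt (hn : 1 ≤ n) (hε : 0 < ε) (hρ : 0 ≤ ρ) (hS : S.PosDef)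
    (hQ : Q.PosSemidef)
    (h : ∀ t, 0 ≤ t → (tiltMatrix ε S Q t).PosDef → gibbsCost ε m S Q q ξ t < ρ) (t : ℝ) :
    (tiltMatrix ε S Q t).PosDef := by
  obtain ⟨s, hs, hsC⟩ := exists_pos_step hQ (show 0 ≤ 2 * ρ / ε by positivity)
  have hk : ∀ k : ℕ, (tiltMatrix ε S Q (k * s)).PosDef := by
    intro k
    induction k with
    | zero => simpa using tiltMatrix_zero_posDef hε hS
    | succ k ih =>
      obtain ⟨-, -, -, -, -, htr⟩ := gibbsCoupling_spec (m := m) (q := q) (ξ := ξ) hn hε hS ih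
      have hlt := h _ (by positivity) ih
      rw [Nat.cast_succ, add_one_mul]
      refine tiltMatrix_posDef_add hQ ih ?_ hs.le hsC
      rw [le_div_iff₀ hε]
      linarith
  obtain ⟨k, hkt⟩ := exists_nat_ge (t / s)
  exact tiltMatrix_posDef_of_le hQ (hk k) ((div_le_iff₀ hs).1 hkt)

open Filter Topology in
lemma dualValue_le_worstCaseRisk (hn : 1 ≤ n) (hε : 0 < ε) (hρ : 0 ≤ ρ) (hS : S.PosDef)
    (hQ : Q.PosSemidef) :
    dualValue ε ρ m S Q q ξ ≤
      worstCaseRisk (sinkhornBall sqDistCost ε ρ (gaussianDist m S) (empiricalMeasure ξ))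
        (quadLoss Q q) := by
  have h0 := tiltMatrix_zero_posDef (Q := Q) hε hS
  rcases lt_or_ge ρ (criticalRadius ε m S ξ) with hlt | hge
  · rw [dualValue_eq_bot_of_lt hn hε hS hQ hlt]
    exact bot_le
  rw [criticalRadius_eq_gibbsCost (Q := Q) (q := q) hn hε hS] at hge
  rcases hge.eq_or_lt with heq | hlt
  -- At the critical radius the optimal multiplier is `λ = ∞`: the dual value is at most `R(t)` for
  -- small `t > 0`, because `c(t) ≥ c(0) = ρ`, and `R(t) → R(0)`.
  · refine le_trans ?_ (gibbsRisk_le_worstCaseRisk hn hε hS h0 hge)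
    have hlim : Tendsto (fun t ↦ ((gibbsRisk ε m S Q q ξ t : ℝ) : EReal)) (𝓝[>] 0)
        (𝓝 ((gibbsRisk ε m S Q q ξ 0 : ℝ) : EReal)) :=
      (continuous_coe_real_ereal.tendsto _).comp
        ((continuousAt_gibbsRisk h0).tendsto.mono_left nhdsWithin_le_nhds)
    refine ge_of_tendsto hlim ?_
    filter_upwards [eventually_tiltMatrix_posDef hε hS hQ] with t ⟨ht0, ht⟩
    refine dualValue_le_gibbsRisk hε ht0 ht ?_
    have := mul_gibbsRisk_le (m := m) (q := q) (ξ := ξ) hn hε hS ht h0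
    rw [← heq, gibbsCost]
    linarith
  -- Either the budget `ρ` is used up exactly at some `t`, or it never is, as for the zero loss.
  by_cases hex : ∃ t, 0 ≤ t ∧ (tiltMatrix ε S Q t).PosDef ∧ ρ ≤ gibbsCost ε m S Q q ξ t
  · obtain ⟨t, ht0, ht, hle⟩ := hex
    have hcont : ContinuousOn (gibbsCost ε m S Q q ξ) (Set.Icc 0 t) := fun s hs ↦
      (continuousAt_gibbsCost (tiltMatrix_posDef_of_le hQ ht hs.2)).continuousWithinAt
    obtain ⟨s, hs, hseq⟩ := intermediate_value_Icc ht0 hcont ⟨hlt.le, hle⟩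
    have hs0 : 0 < s := hs.1.lt_of_ne fun h ↦ by
      rw [← h] at hseq
      exact hlt.ne hseq
    have hspd := tiltMatrix_posDef_of_le hQ ht hs.2
    exact (dualValue_le_gibbsRisk hε hs0 hspd hseq.ge).trans
      (gibbsRisk_le_worstCaseRisk hn hε hS hspd hseq.le)
  · push Not at hex
    have hpd := tiltMatrix_posDef_of_gibbsCost_lt hn hε hρ hS hQ hex
    by_contra! hcon
    obtain ⟨r, hr1, hr2⟩ := EReal.lt_iff_exists_real_btwn.1 hcon
    obtain ⟨r', hr1', hr2'⟩ := EReal.lt_iff_exists_real_btwn.1 hr2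
    have hrr : r < r' := EReal.coe_lt_coe_iff.1 hr1'
    have hsub : 0 < r' - r := sub_pos.2 hrr
    -- Chosen so that `(r' - r) t > ρ`, whereas the gap `(ρ - c(t))/t` is at most `ρ/t`.
    set t := ρ / (r' - r) + 1 with htdef
    have ht0 : 0 < t := by positivity
    have h1 := EReal.coe_lt_coe_iff.1 (hr2'.trans_le (dualValue_le hε ht0 (hpd t)))
    have h2 := EReal.coe_lt_coe_iff.1 ((gibbsRisk_le_worstCaseRisk hn hε hS (hpd t)
      (hex t ht0.le (hpd t)).le).trans_lt hr1)
    have h3 := gibbsCost_nonneg (m := m) (q := q) (ξ := ξ) hn hε hS (hpd t)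
    rw [gibbsCost] at h3
    rw [lt_div_iff₀ ht0] at h1
    have h4 : (r' - r) * t = ρ + (r' - r) := by
      rw [htdef]
      field_simp
    have h5 := mul_lt_mul_of_pos_right h2 ht0
    linarith

end Duality
theorem lemma1 (d n : ℕ) (hn : 1 ≤ n) (ε ρ : ℝ) (hε : 0 < ε) (hρ : 0 ≤ ρ)
    (m : EuclideanSpace ℝ (Fin d)) (S : Matrix (Fin d) (Fin d) ℝ) (hS : S.PosDef)
    (Q : Matrix (Fin d) (Fin d) ℝ) (hQ : Q.PosSemidef) (q : EuclideanSpace ℝ (Fin d))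
    (ξ : Fin n → EuclideanSpace ℝ (Fin d)) :
    -- the expectations in the worst-case risk are well defined
    (∀ P ∈ sinkhornBall sqDistCost ε ρ (gaussianDist m S) (empiricalMeasure ξ),
      Integrable (quadLoss Q q) P) ∧
    -- feasibility of the worst-case risk problem
    ((sinkhornBall sqDistCost ε ρ (gaussianDist m S) (empiricalMeasure ξ)).Nonempty ↔
      criticalRadius ε m S ξ ≤ ρ) ∧
    -- the dual program is convex: convex feasible set and convex objective
    ConvexOn ℝ (dualFeasible ε m S Q q ξ) (dualObjective ρ) ∧
    -- the optimal values coincide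
    worstCaseRisk (sinkhornBall sqDistCost ε ρ (gaussianDist m S) (empiricalMeasure ξ))
        (quadLoss Q q) =
      dualValue ε ρ m S Q q ξ := by
  refine ⟨fun P hP ↦ ?_, nonempty_sinkhornBall_iff hn hε hρ hS, convexOn_dualObjective hε hS hQ,
    le_antisymm (worstCaseRisk_le_dualValue hn hε hρ hS hQ)
      (dualValue_le_worstCaseRisk hn hε hρ hS hQ)⟩
  have := hP.1
  exact integrable_quadLoss (memLp_two_of_mem_sinkhornBall hn hρ hP) Q q
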